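/- Let $(X,d)$ be a proper geodesic metric space which is $\delta$-hyperbolic for some $\delta\ge 0$: whenever $[x,y]$, $[x,z]$, $[z,y]$ are geodesic segments joining three points of $X$, every point of $[x,y]$ is at distance at most $\delta$ from $[x,z]\cup[z,y]$. Write $(y,z)_o=\tfrac12\bigl(d(o,y)+d(o,z)-d(y,z)\bigr)$, and let the hyperbolic boundary $\partial X$ be the set of sequences $(x_n)$ in $X$ with $\lim_{n,m\to\infty}(x_n,x_m)_o=\infty$, modulo the relation $(x_n)\sim(y_n)$ iff $\lim_{n,m\to\infty}(x_n,y_m)_o=\infty$ (this does not depend on the base point $o\in X$). Give $X\cup\partial X$ its usual topology: $U$ is open iff $U\cap X$ is open in $X$ and for each $\xi\in U\cap\partial X$ there is $r$ such that $U$ contains all $y\in X$ with $(x_n,y)_o\ge r$ for all large $n$, for some $(x_n)$ representing $\xi$, and all $\eta\in\partial X$ with $(x_n,y_m)_o\ge r$ for all large $n,m$, for some $(x_n)$ representing $\xi$ and some $(y_m)$ representing $\eta$. Suppose that $\partial X$ contains at least three points. Let $G$ be a countable group acting on $X$ by isometries, and let $\mu$ be a probability measure on $G$ with finite first moment, i.e.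 $\int_G d(x,gx)\,d\mu(g)<\infty$ for some $x\in X$. Suppose that the subgroup $H$ of $G$ generated by the support of $\mu$ is non-elementary, i.e. no non-empty finite subset $S\subseteq\partial X$ satisfies $hS=S$ for all $h\in H$, and that $H$ has an unbounded orbit in $X$. Let $w_n=g_1g_2\cdots g_n$, where $(g_i)_{i\ge1}$ are independent with law $\mu$. Then there is a constant $A\ge 0$ such that for every $x\in X$, for almost every sample path, $(w_nx)$ converges in $X\cup\partial X$ to some point of $\partial X$, and there is a geodesic ray (isometric embedding) $\gamma:[0,\infty)\to X$ with $\gamma(0)=x$ and $$\lim_{n\to\infty}\frac{d(w_nx,\gamma(An))}{n}=0 .$$ -/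

import Mathlib

open Filter Topology MeasureTheory
open scoped NNReal

namespace Hyperbolic

section Geometry

variable {X : Type*} [MetricSpace X]

/-- `S` is (the image of) a geodesic segment from `x` to `y`. -/
def IsGeodesicSegment (S : Set X) (x y : X) : Prop :=
  ∃ (L : ℝ) (γ : ℝ → X), 0 ≤ L ∧
    (∀ s ∈ Set.Icc 0 L, ∀ t ∈ Set.Icc 0 L, dist (γ s) (γ t) = |s - t|) ∧
    γ 0 = x ∧ γ L = y ∧ S = γ '' Set.Icc 0 L

variable (X) in
/-- Any two points are joined by a geodesic segment. -/
def IsGeodesicSpace : Prop :=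
  ∀ x y : X, ∃ S : Set X, IsGeodesicSegment S x y

variable (X) in
/-- Geodesic triangles are `δ`-thin: each side lies in the (closed) `δ`-neighbourhood of the union
of the two others. -/
def IsDeltaHyperbolic (δ : ℝ) : Prop :=
  ∀ (x y z : X) (Sxy Sxz Szy : Set X),
    IsGeodesicSegment Sxy x y → IsGeodesicSegment Sxz x z → IsGeodesicSegment Szy z y →
      ∀ p ∈ Sxy, ∃ q ∈ Sxz ∪ Szy, dist p q ≤ δ

/-- The Gromov product `(y, z)_o`. -/
noncomputable def gromovProduct (o y z : X) : ℝ :=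
  (dist o y + dist o z - dist y z) / 2

/-- `(u_n, v_m)_o → ∞` as `n, m → ∞`. Changing `o` changes the product by a bounded amount, so
that it is the same to ask it for one base point or for all. -/
def GromovAsymptotic (u v : ℕ → X) : Prop :=
  ∀ o : X, Tendsto (fun p : ℕ × ℕ => gromovProduct o (u p.1) (v p.2)) atTop atTop

variable (X) in
/-- The sequences `(x_n)` with `(x_n, x_m)_o → ∞`. -/
def GromovSequence : Type _ := {u : ℕ → X // GromovAsymptotic u u}

variable (X) in
/-- The hyperbolic boundary: Gromov sequences modulo `(x_n) ∼ (y_n)` iff `(x_n, y_m)_o → ∞`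
(which is an equivalence relation when `X` is hyperbolic). -/
def Boundary : Type _ :=
  Quot (fun u v : GromovSequence X => GromovAsymptotic u.1 v.1)

/-- The boundary point represented by a Gromov sequence. -/
def Boundary.mk (u : GromovSequence X) : Boundary X := Quot.mk _ u

variable (X) in
/-- The hyperbolic compactification `X ∪ ∂X`, as a set. -/
inductive Compactification : Type _
  | pt (x : X) : Compactification
  | bdry (ξ : Boundary X) : Compactification

/-- The basic neighbourhood of a boundary point `ξ`: the points `z` of `X ∪ ∂X` whose Gromov
product with `ξ`, based at `o`, is at least `r` along suitable sequences representing `ξ` (and `z`,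
if `z` is a boundary point). -/
def basicNhd (o : X) (ξ : Boundary X) (r : ℝ) : Set (Compactification X) :=
  {z | match z with
    | .pt y => ∃ u : GromovSequence X, Boundary.mk u = ξ ∧
        ∀ᶠ n in atTop, r ≤ gromovProduct o (u.1 n) y
    | .bdry η => ∃ u v : GromovSequence X, Boundary.mk u = ξ ∧ Boundary.mk v = η ∧
        ∀ᶠ p : ℕ × ℕ in atTop, r ≤ gromovProduct o (u.1 p.1) (v.1 p.2)}

theorem basicNhd_anti (o : X) (ξ : Boundary X) {r s : ℝ} (h : r ≤ s) :
    basicNhd o ξ s ⊆ basicNhd o ξ r := by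
  rintro (y | η) hz
  · obtain ⟨u, hu, h'⟩ := hz
    exact ⟨u, hu, h'.mono fun _ hn => h.trans hn⟩
  · obtain ⟨u, v, hu, hv, h'⟩ := hz
    exact ⟨u, v, hu, hv, h'.mono fun _ hn => h.trans hn⟩

/-- The topology of `X ∪ ∂X`: a set is open if it meets `X` in an open set and contains, with each
of its boundary points, a basic neighbourhood of that point. -/
instance : TopologicalSpace (Compactification X) where
  IsOpen U := IsOpen {x : X | Compactification.pt x ∈ U} ∧
    ∀ ξ : Boundary X, Compactification.bdry ξ ∈ U → ∀ o : X, ∃ r : ℝ, basicNhd o ξ r ⊆ U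
  isOpen_univ := ⟨by simp, fun _ _ _ => ⟨0, Set.subset_univ _⟩⟩
  isOpen_inter U V hU hV := by
    refine ⟨hU.1.inter hV.1, fun ξ hξ o => ?_⟩
    obtain ⟨r, hr⟩ := hU.2 ξ hξ.1 o
    obtain ⟨s, hs⟩ := hV.2 ξ hξ.2 o
    exact ⟨max r s, Set.subset_inter ((basicNhd_anti o ξ (le_max_left r s)).trans hr)
      ((basicNhd_anti o ξ (le_max_right r s)).trans hs)⟩
  isOpen_sUnion 𝒰 h𝒰 := by
    refine ⟨?_, ?_⟩
    · have : {x : X | Compactification.pt x ∈ ⋃₀ 𝒰}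
          = ⋃ U ∈ 𝒰, {x : X | Compactification.pt x ∈ U} := by
        ext x; simp
      rw [this]
      exact isOpen_biUnion fun U hU => (h𝒰 U hU).1
    · rintro ξ ⟨U, hU, hξ⟩ o
      obtain ⟨r, hr⟩ := (h𝒰 U hU).2 ξ hξ o
      exact ⟨r, hr.trans (Set.subset_sUnion_of_mem hU)⟩

end Geometry

section Action

variable {G X : Type*} [Group G] [MetricSpace X] [MulAction G X] [IsIsometricSMul G X]

theorem GromovAsymptotic.smul (g : G) {u v : ℕ → X} (h : GromovAsymptotic u v) :
    GromovAsymptotic (fun n => g • u n) (fun n => g • v n) := by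
  intro o
  have key : ∀ y z : X, gromovProduct o (g • y) (g • z) = gromovProduct (g⁻¹ • o) y z := by
    intro y z
    have h1 : ∀ w : X, dist o (g • w) = dist (g⁻¹ • o) w := fun w => by
      rw [← dist_smul g (g⁻¹ • o) w, smul_inv_smul]
    simp only [gromovProduct, h1, dist_smul]
  simpa only [key] using h (g⁻¹ • o)

/-- The action on the boundary: `g • [(x_n)] = [(g • x_n)]`. -/
instance : MulAction G (Boundary X) where
  smul g := Quot.map (fun u : GromovSequence X => ⟨fun n => g • u.1 n, u.2.smul g⟩)
    (fun _ _ h => h.smul g)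
  one_smul := by
    rintro ⟨u⟩
    exact congrArg (Quot.mk _) (Subtype.ext (funext fun n => one_smul G (u.1 n)))
  mul_smul g h := by
    rintro ⟨u⟩
    exact congrArg (Quot.mk _) (Subtype.ext (funext fun n => mul_smul g h (u.1 n)))

variable (X) in
/-- A subgroup is elementary if it preserves some non-empty finite subset of `∂X`. -/
def IsElementary (H : Subgroup G) : Prop :=
  ∃ S : Set (Boundary X), S.Finite ∧ S.Nonempty ∧ ∀ h ∈ H, (fun ξ => h • ξ) '' S = S

end Action

section Walk

variable {G : Type*} [Group G]

/-- The position `w_n = g_1 ⋯ g_n` of the walk with increments `g_1 = ω 0, g_2 = ω 1, …`. -/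
def walk (ω : ℕ → G) : ℕ → G
  | 0 => 1
  | n + 1 => walk ω n * ω n

/-- The law `μ^ℕ` of the sequence of increments. -/
noncomputable def stepLaw [MeasurableSpace G] (μ : Measure G) [IsProbabilityMeasure μ] :
    Measure (ℕ → G) :=
  Measure.infinitePi fun _ : ℕ => μ

/-- The subgroup generated by the support of `μ`, for a measure on a countable group. -/
def supportSubgroup [MeasurableSpace G] (μ : Measure G) : Subgroup G :=
  Subgroup.closure {g | μ {g} ≠ 0}

variable (X : Type*) [MetricSpace X] [MulAction G X]

/-- The average step size is finite. -/
def HasFiniteFirstMoment [MeasurableSpace G] (μ : Measure G) : Prop :=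
  ∃ x : X, Integrable (fun g : G => dist x (g • x)) μ

end Walk

end Hyperbolic

namespace Hyperbolic

/-! ### Elementary inequalities for Gromov products. -/

section GromovProduct

variable {X : Type*} [MetricSpace X]

/-! The geometric part is deterministic (`FourPoint.exists_ray_tracking`). Let p_n go to infinity
with d(x,p_n)/n → A and steps of size o(n). If A > 0, the four point condition makes (p_n,p_m)_x at
least (A-ε)n up to a constant, for all m ≥ n. Geodesics from x to p_n and p_m therefore
fellow-travel up to that time, and a limit ray passes within a small multiple of n from p_n at time
An. If A = 0 any ray from x will do.

The probabilistic part checks these conditions for p_n = w_n x. Steps are o(n) by the strong law.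
The rate A comes from a subadditive argument (`exists_drift`): blocks and the strong law bound the
limsup of d(o,w_n o)/n by A, while a covering argument shows that the liminf has integral at least
A. Together these force the liminf to equal A almost surely.

Convergence to the boundary must also be proved when A = 0, so it is obtained separately
(`ae_gromovAsymptotic_walk`). In place of a stationary measure on the boundary, the proof uses a
stationary finitely additive probability m on all subsets of X. A maximum principle shows that atoms
of m at infinity would give a finite invariant set in ∂X. So there are none, and by properness deep
shadows {z | T ≤ (z,p)_o} have uniformly small mass (`exists_shadow_le`). Hence if g moves o far,
the translate of m by g is concentrated near g o. By stationarity h ↦ m{z | R ≤ (h z, g o)_o} is a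
bounded harmonic function, so it converges along almost every path. Concentration along an unbounded
subsequence then propagates to the whole path (`gromovAsymptotic_of_tendsto_content`). Paths are
unbounded because the semigroup generated by the support has an unbounded orbit and every finite
pattern of increments of positive probability occurs. -/

theorem gromovProduct_comm (o y z : X) : gromovProduct o y z = gromovProduct o z y := by
  simp only [gromovProduct, dist_comm y z]; ring

theorem gromovProduct_le_left (o y z : X) : gromovProduct o y z ≤ dist o y := by
  have := dist_triangle o y z
  simp only [gromovProduct]; linarith

theorem gromovProduct_le_right (o y z : X) : gromovProduct o y z ≤ dist o z := by
  rw [gromovProduct_comm]; exact gromovProduct_le_left o z y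

theorem gromovProduct_le_add_base (o o' y z : X) :
    gromovProduct o y z ≤ gromovProduct o' y z + dist o o' := by
  have h1 := dist_triangle o o' y
  have h2 := dist_triangle o o' z
  simp only [gromovProduct]; linarith

theorem gromovProduct_le_add_left (o y y' z : X) :
    gromovProduct o y z ≤ gromovProduct o y' z + dist y y' := by
  have h1 := dist_triangle o y' y
  have h2 := dist_triangle y' y z
  rw [dist_comm y' y] at h1 h2
  simp only [gromovProduct]; linarith

theorem gromovProduct_add_gromovProduct (o p z : X) :
    gromovProduct p z o + gromovProduct o z p = dist o p := by
  simp only [gromovProduct, dist_comm p z, dist_comm p o, dist_comm z o]; ring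

theorem gromovProduct_smul {G : Type*} [Group G] [MulAction G X] [IsIsometricSMul G X]
    (g : G) (o y z : X) :
    gromovProduct o (g • y) z = gromovProduct (g⁻¹ • o) y (g⁻¹ • z) := by
  have h1 : ∀ u v : X, dist u (g • v) = dist (g⁻¹ • u) v := fun u v => by
    rw [← dist_smul g (g⁻¹ • u) v, smul_inv_smul]
  simp only [gromovProduct, dist_comm (g • y) z, dist_comm y, h1, dist_smul]

/-- It suffices to check `GromovAsymptotic` at one base point. -/
theorem gromovAsymptotic_of_base (o : X) {u v : ℕ → X}
    (h : Tendsto (fun p : ℕ × ℕ => gromovProduct o (u p.1) (v p.2)) atTop atTop) :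
    GromovAsymptotic u v := by
  intro o'
  refine tendsto_atTop_mono (fun p => ?_) (tendsto_atTop_add_const_right _ (-dist o o') h)
  have := gromovProduct_le_add_base o o' (u p.1) (v p.2)
  linarith

theorem gromovAsymptotic_iff (o : X) {u v : ℕ → X} :
    GromovAsymptotic u v ↔
      ∀ R : ℝ, ∃ N, ∀ n ≥ N, ∀ m ≥ N, R ≤ gromovProduct o (u n) (v m) := by
  constructor
  · intro h R
    obtain ⟨⟨a, b⟩, hab⟩ := eventually_atTop.1 ((tendsto_atTop.1 (h o)) R)
    exact ⟨max a b, fun n hn m hm =>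
      hab (n, m) ⟨(le_max_left a b).trans hn, (le_max_right a b).trans hm⟩⟩
  · intro h
    refine gromovAsymptotic_of_base o (tendsto_atTop.2 fun R => ?_)
    obtain ⟨N, hN⟩ := h R
    exact eventually_atTop.2 ⟨(N, N), fun p hp => hN _ hp.1 _ hp.2⟩

/-- A Gromov sequence converges in `X ∪ ∂X` to the boundary point that it represents. -/
theorem tendsto_boundary_mk (u : GromovSequence X) :
    Tendsto (fun n => Compactification.pt (u.1 n)) atTop
      (𝓝 (Compactification.bdry (Boundary.mk u))) := by
  rw [tendsto_nhds]
  intro U hU hξ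
  obtain ⟨r, hr⟩ := hU.2 _ hξ (u.1 0)
  obtain ⟨N, hN⟩ := (gromovAsymptotic_iff (u.1 0)).1 u.2 r
  filter_upwards [eventually_ge_atTop N] with n hn
  exact hr ⟨u, rfl, eventually_atTop.2 ⟨N, fun m hm => hN m hm n hn⟩⟩

end GromovProduct

/-! ### From thin triangles to the four point condition. -/

section FourPoint

variable {X : Type*} [MetricSpace X]

variable (X) in
/-- Gromov's four point condition. -/
def FourPoint (κ : ℝ) : Prop :=
  ∀ o x y z : X, min (gromovProduct o x y) (gromovProduct o y z) - κ ≤ gromovProduct o x z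

theorem FourPoint.le {κ : ℝ} (h : FourPoint X κ) {o x y z : X} {R : ℝ}
    (h1 : R ≤ gromovProduct o x y) (h2 : R ≤ gromovProduct o y z) :
    R - κ ≤ gromovProduct o x z := by
  have := h o x y z
  have := le_min h1 h2
  linarith

theorem FourPoint.nonneg [Nonempty X] {κ : ℝ} (h : FourPoint X κ) : 0 ≤ κ := by
  obtain ⟨x⟩ := ‹Nonempty X›
  simpa [gromovProduct] using h x x x x

theorem IsGeodesicSegment.symm {S : Set X} {x y : X} (h : IsGeodesicSegment S x y) :
    IsGeodesicSegment S y x := by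
  obtain ⟨L, γ, hL, hiso, h0, h1, rfl⟩ := h
  refine ⟨L, fun t => γ (L - t), hL, fun s hs t ht => ?_, by simpa using h1, by simpa using h0, ?_⟩
  · rw [hiso _ ⟨by linarith [hs.2], by linarith [hs.1]⟩ _ ⟨by linarith [ht.2], by linarith [ht.1]⟩,
      abs_sub_comm]
    congr 1; ring
  · ext p
    constructor
    · rintro ⟨t, ht, rfl⟩
      exact ⟨L - t, ⟨by linarith [ht.2], by linarith [ht.1]⟩, by simp⟩
    · rintro ⟨t, ht, rfl⟩
      exact ⟨L - t, ⟨by linarith [ht.2], by linarith [ht.1]⟩, rfl⟩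

theorem IsGeodesicSegment.dist_add_dist {S : Set X} {x y p : X} (h : IsGeodesicSegment S x y)
    (hp : p ∈ S) : dist x p + dist p y = dist x y := by
  obtain ⟨L, γ, hL, hiso, rfl, rfl, rfl⟩ := h
  obtain ⟨t, ht, rfl⟩ := hp
  have h0 : (0 : ℝ) ∈ Set.Icc 0 L := ⟨le_rfl, hL⟩
  have h1 : L ∈ Set.Icc 0 L := ⟨hL, le_rfl⟩
  rw [hiso _ h0 _ ht, hiso _ ht _ h1, hiso _ h0 _ h1, abs_of_nonpos (by linarith [ht.1]),
    abs_of_nonpos (by linarith [ht.2]), abs_of_nonpos (by linarith)]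
  ring

theorem IsGeodesicSegment.continuousOn {L : ℝ} {γ : ℝ → X}
    (hiso : ∀ s ∈ Set.Icc 0 L, ∀ t ∈ Set.Icc 0 L, dist (γ s) (γ t) = |s - t|) :
    ContinuousOn γ (Set.Icc 0 L) := by
  have : LipschitzOnWith 1 γ (Set.Icc 0 L) :=
    LipschitzOnWith.of_dist_le_mul fun s hs t ht => by
      rw [hiso s hs t ht, Real.dist_eq]; simp
  exact this.continuousOn

theorem IsGeodesicSegment.isCompact {S : Set X} {x y : X} (h : IsGeodesicSegment S x y) :
    IsCompact S := by
  obtain ⟨L, γ, hL, hiso, h0, h1, rfl⟩ := h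
  exact isCompact_Icc.image_of_continuousOn (continuousOn hiso)

theorem IsGeodesicSegment.isPreconnected {S : Set X} {x y : X} (h : IsGeodesicSegment S x y) :
    IsPreconnected S := by
  obtain ⟨L, γ, hL, hiso, h0, h1, rfl⟩ := h
  exact isPreconnected_Icc.image _ (continuousOn hiso)

theorem IsGeodesicSegment.left_mem {S : Set X} {x y : X} (h : IsGeodesicSegment S x y) :
    x ∈ S := by
  obtain ⟨L, γ, hL, hiso, rfl, h1, rfl⟩ := h
  exact ⟨0, ⟨le_rfl, hL⟩, rfl⟩

theorem IsGeodesicSegment.right_mem {S : Set X} {x y : X} (h : IsGeodesicSegment S x y) :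
    y ∈ S := h.symm.left_mem

theorem IsGeodesicSegment.gromovProduct_le {S : Set X} {x y p : X}
    (h : IsGeodesicSegment S x y) (hp : p ∈ S) (o : X) : gromovProduct o x y ≤ dist o p := by
  have h1 := h.dist_add_dist hp
  have h2 := dist_triangle o p x
  have h3 := dist_triangle o p y
  rw [dist_comm p x] at h2
  simp only [gromovProduct]; linarith

/-- The segment is connected and covered by the closed δ-neighbourhoods of [x,o] and [o,y], each of
which it meets; so some p lies in both. The bounds for d(o,p) obtained through the two sides average
to the Gromov product plus 2δ. -/
theorem IsGeodesicSegment.exists_dist_le_gromovProduct (hgeod : IsGeodesicSpace X) {δ : ℝ}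
    (hhyp : IsDeltaHyperbolic X δ) {S : Set X} {x y : X}
    (h : IsGeodesicSegment S x y) (o : X) :
    ∃ p ∈ S, dist o p ≤ gromovProduct o x y + 2 * δ := by
  obtain ⟨S₁, h₁⟩ := hgeod x o
  obtain ⟨S₂, h₂⟩ := hgeod o y
  have hcov := hhyp x y o S S₁ S₂ h h₁ h₂
  have hne₁ : S₁.Nonempty := ⟨x, h₁.left_mem⟩
  have hne₂ : S₂.Nonempty := ⟨y, h₂.right_mem⟩
  have hδ : 0 ≤ δ := by
    obtain ⟨q, -, hq⟩ := hcov x h.left_mem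
    exact dist_nonneg.trans hq
  have hcl : ∀ T : Set X, IsClosed {p | Metric.infDist p T ≤ δ} := fun T =>
    isClosed_le (Metric.continuous_infDist_pt T) continuous_const
  obtain ⟨p, hpS, hp₁, hp₂⟩ := isPreconnected_closed_iff.1 h.isPreconnected
    {p | Metric.infDist p S₁ ≤ δ} {p | Metric.infDist p S₂ ≤ δ} (hcl S₁) (hcl S₂)
    (fun p hp => by
      obtain ⟨q, hq | hq, hpq⟩ := hcov p hp
      · exact Or.inl ((Metric.infDist_le_dist_of_mem hq).trans hpq)
      · exact Or.inr ((Metric.infDist_le_dist_of_mem hq).trans hpq))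
    ⟨x, h.left_mem, by simp [Metric.infDist_zero_of_mem h₁.left_mem, hδ]⟩
    ⟨y, h.right_mem, by simp [Metric.infDist_zero_of_mem h₂.right_mem, hδ]⟩
  obtain ⟨q₁, hq₁, e₁⟩ := h₁.isCompact.exists_infDist_eq_dist hne₁ p
  obtain ⟨q₂, hq₂, e₂⟩ := h₂.isCompact.exists_infDist_eq_dist hne₂ p
  have d₁ : dist p q₁ ≤ δ := e₁ ▸ hp₁
  have d₂ : dist p q₂ ≤ δ := e₂ ▸ hp₂
  refine ⟨p, hpS, ?_⟩
  have a := h.dist_add_dist hpS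
  have b := h₁.dist_add_dist hq₁
  have c := h₂.dist_add_dist hq₂
  have t1 := dist_triangle x q₁ p
  have t2 := dist_triangle o q₁ p
  have t3 := dist_triangle o q₂ p
  have t4 := dist_triangle p q₂ y
  rw [dist_comm q₁ p] at t1 t2
  rw [dist_comm q₂ p] at t3
  rw [dist_comm q₁ o, dist_comm x o] at b
  simp only [gromovProduct]; linarith

/-- Up to bounded error the Gromov product is the distance from o to the segment. A nearly closest
point of [x,z], within 2δ of the product, lies δ-close to [x,y] or [y,z], which gives 3δ. -/
theorem IsDeltaHyperbolic.fourPoint (hgeod : IsGeodesicSpace X) {δ : ℝ}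
    (hhyp : IsDeltaHyperbolic X δ) : FourPoint X (3 * δ) := by
  intro o x y z
  obtain ⟨S, h⟩ := hgeod x z
  obtain ⟨S₁, h₁⟩ := hgeod x y
  obtain ⟨S₂, h₂⟩ := hgeod y z
  obtain ⟨p, hp, hop⟩ := h.exists_dist_le_gromovProduct hgeod hhyp o
  obtain ⟨q, hq, hpq⟩ := hhyp x z y S S₁ S₂ h h₁ h₂ p hp
  have t := dist_triangle o p q
  rcases hq with hq | hq
  · have := h₁.gromovProduct_le hq o
    have := min_le_left (gromovProduct o x y) (gromovProduct o y z)
    linarith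
  · have := h₂.gromovProduct_le hq o
    have := min_le_right (gromovProduct o x y) (gromovProduct o y z)
    linarith

end FourPoint

/-! ### Geodesics from a common origin. -/

section Segments

variable {X : Type*} [MetricSpace X]

/-- A unit speed geodesic from `x` to `y`, stopped at `y`. -/
theorem IsGeodesicSpace.exists_path (hgeod : IsGeodesicSpace X) (x y : X) :
    ∃ σ : ℝ → X, σ 0 = x ∧ σ (dist x y) = y ∧ (∀ t, 0 ≤ t → dist x (σ t) ≤ t) ∧
      ∀ s ∈ Set.Icc 0 (dist x y), ∀ t ∈ Set.Icc 0 (dist x y), dist (σ s) (σ t) = |s - t| := by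
  obtain ⟨S, L, γ, hL, hiso, rfl, rfl, -⟩ := hgeod x y
  have h0 : (0 : ℝ) ∈ Set.Icc 0 L := ⟨le_rfl, hL⟩
  have e : dist (γ 0) (γ L) = L := by
    rw [hiso _ h0 _ ⟨hL, le_rfl⟩, abs_of_nonpos (by linarith)]; ring
  rw [e]
  refine ⟨fun t => γ (min t L), by simp [hL], by simp, fun t ht => ?_, fun s hs t ht => ?_⟩
  · have hm : (0 : ℝ) ≤ min t L := le_min ht hL
    rw [hiso _ h0 _ ⟨hm, min_le_right t L⟩, abs_of_nonpos (by linarith)]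
    linarith [min_le_left t L]
  · simp only [min_eq_left hs.2, min_eq_left ht.2]
    exact hiso s hs t ht

theorem gromovProduct_ge_of_dist_le {x p q a b : X} {T c : ℝ}
    (ha : dist x a = T) (hap : dist x a + dist a p = dist x p)
    (hb : dist x b = T) (hbq : dist x b + dist b q = dist x q) (hab : dist a b ≤ c) :
    T - c / 2 ≤ gromovProduct x p q := by
  have h1 := dist_triangle p a q
  have h2 := dist_triangle a b q
  rw [dist_comm p a] at h1
  simp only [gromovProduct]; linarith

theorem path_dist {x y : X} {σ : ℝ → X} (h0 : σ 0 = x) (h1 : σ (dist x y) = y)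
    (hiso : ∀ s ∈ Set.Icc 0 (dist x y), ∀ t ∈ Set.Icc 0 (dist x y), dist (σ s) (σ t) = |s - t|)
    {t : ℝ} (ht : t ∈ Set.Icc 0 (dist x y)) :
    dist x (σ t) = t ∧ dist (σ t) y = dist x y - t := by
  have a := hiso 0 ⟨le_rfl, dist_nonneg⟩ t ht
  have b := hiso t ht (dist x y) ⟨dist_nonneg, le_rfl⟩
  rw [h0, abs_of_nonpos (by linarith [ht.1])] at a
  rw [h1, abs_of_nonpos (by linarith [ht.2])] at b
  exact ⟨by linarith, by linarith⟩

/-- In a proper geodesic space, a sequence tending to infinity has a Gromov subsequence. -/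
theorem exists_gromov_subseq [ProperSpace X] (hgeod : IsGeodesicSpace X) (o : X) {p : ℕ → X}
    (hp : Tendsto (fun n => dist o (p n)) atTop atTop) :
    ∃ φ : ℕ → ℕ, StrictMono φ ∧ GromovAsymptotic (p ∘ φ) (p ∘ φ) := by
  choose σ h0 h1 hle hiso using fun n => hgeod.exists_path o (p n)
  -- By Tychonoff, one subsequence makes the geodesics from o converge at all integer times
  -- simultaneously. Agreement up to distance 1 at time T gives product at least T - 1/2.
  have hK : IsCompact (Set.univ.pi fun T : ℕ => Metric.closedBall o (T : ℝ)) :=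
    isCompact_univ_pi fun T => isCompact_closedBall o _
  obtain ⟨a, -, φ, hφ, hlim⟩ := hK.tendsto_subseq (x := fun n (T : ℕ) => σ n (T : ℝ))
    (fun n T _ => by
      rw [Metric.mem_closedBall, dist_comm]; exact hle n _ (Nat.cast_nonneg T))
  rw [tendsto_pi_nhds] at hlim
  refine ⟨φ, hφ, (gromovAsymptotic_iff o).2 fun R => ?_⟩
  obtain ⟨T, hT⟩ := exists_nat_ge (R + 1)
  have e1 : ∀ᶠ n in atTop, dist (σ (φ n) T) (a T) < 1 / 2 :=
    (Metric.tendsto_nhds.1 (hlim T)) _ (by norm_num)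
  have e2 : ∀ᶠ n in atTop, (T : ℝ) ≤ dist o (p (φ n)) :=
    hφ.tendsto_atTop.eventually (hp.eventually_ge_atTop (T : ℝ))
  obtain ⟨N, hN⟩ := eventually_atTop.1 (e1.and e2)
  refine ⟨N, fun n hn m hm => ?_⟩
  obtain ⟨n1, n2⟩ := hN n hn
  obtain ⟨m1, m2⟩ := hN m hm
  have ⟨pn, pn'⟩ := path_dist (h0 _) (h1 _) (hiso (φ n)) ⟨Nat.cast_nonneg T, n2⟩
  have ⟨pm, pm'⟩ := path_dist (h0 _) (h1 _) (hiso (φ m)) ⟨Nat.cast_nonneg T, m2⟩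
  have t := dist_triangle_right (σ (φ n) T) (σ (φ m) T) (a T)
  have := gromovProduct_ge_of_dist_le (p := p (φ n)) (q := p (φ m)) (c := 1) pn (by linarith) pm (by linarith)
    (by linarith)
  simp only [Function.comp]
  linarith

/-- Geodesics with the same origin stay close up to the Gromov product of their end points. -/
theorem FourPoint.dist_path_le {κ : ℝ} (hκ : FourPoint X κ) {x p q a b : X} {T : ℝ}
    (ha : dist x a = T) (hap : dist x a + dist a p = dist x p)
    (hb : dist x b = T) (hbq : dist x b + dist b q = dist x q)
    (hT : T ≤ gromovProduct x p q) : dist a b ≤ 4 * κ := by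
  have : Nonempty X := ⟨x⟩
  have hκ0 := hκ.nonneg
  -- A point on a geodesic from x to p has product with p equal to its distance from x. The chain a,
  -- p, q, b costs two uses of the four point condition, and d(a,b) = 2T - 2(a,b)_x.
  have h1 : T ≤ gromovProduct x a p := by simp only [gromovProduct]; linarith
  have h2 : T ≤ gromovProduct x q b := by
    rw [gromovProduct_comm]; simp only [gromovProduct]; linarith
  have h3 := hκ.le h1 hT
  have h4 := hκ.le h3 (by linarith : T - κ ≤ gromovProduct x q b)
  simp only [gromovProduct] at h4
  linarith

end Segments

/-! ### Sublinear tracking by a ray. -/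

section Tracking

variable {X : Type*} [MetricSpace X]

/-- A sequence with linear escape and sublinear steps has linearly growing Gromov products. -/
theorem FourPoint.linear_le_gromovProduct {κ : ℝ} (hκ : FourPoint X κ) (x : X) (p : ℕ → X)
    {A : ℝ} (hA : Tendsto (fun n : ℕ => dist x (p n) / n) atTop (𝓝 A))
    (hstep : Tendsto (fun n : ℕ => dist (p n) (p (n + 1)) / n) atTop (𝓝 0))
    {ε : ℝ} (hε : 0 < ε) (hεA : ε < A) :
    ∃ N : ℕ, ∀ n ≥ N, ∀ m ≥ n, (A - ε) * n - κ ≤ gromovProduct x (p n) (p m) := by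
  have : Nonempty X := ⟨x⟩
  have hκ0 := hκ.nonneg
  -- K steps increase the lower bound (A-ε)n by at least κ, which pays for one use of the four point
  -- condition.
  obtain ⟨K, hK⟩ := exists_nat_ge (κ / (A - ε) + 1)
  have hAε : 0 < A - ε := by linarith
  have hK1 : (1 : ℝ) ≤ K := by
    have : 0 ≤ κ / (A - ε) := by positivity
    linarith
  have hKκ : κ ≤ (A - ε) * K := by
    have : κ / (A - ε) ≤ K := by linarith
    rwa [div_le_iff₀ hAε, mul_comm] at this
  -- The product of p_n with a point at most K steps later loses ηn from the rate and at most ηKn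
  -- from half the jump 2ηKn: in total εn.
  set η := ε / (K + 1) with hη
  have hη0 : 0 < η := by positivity
  have hηK : η * (K + 1) = ε := by rw [hη]; field_simp
  have hηε : η ≤ ε := by nlinarith
  obtain ⟨N, hN⟩ := eventually_atTop.1 (((eventually_gt_atTop 0).and
    (hA.eventually_const_lt (show A - η < A by linarith))).and
    (hstep.eventually_lt_const hη0))
  have hfar : ∀ n ≥ N, (A - η) * n ≤ dist x (p n) := fun n hn => by
    obtain ⟨⟨h0, h1⟩, -⟩ := hN n hn
    rw [lt_div_iff₀ (by exact_mod_cast h0)] at h1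
    exact h1.le
  have hnear : ∀ n ≥ N, dist (p n) (p (n + 1)) ≤ η * n := fun n hn => by
    obtain ⟨⟨h0, -⟩, h1⟩ := hN n hn
    rw [div_lt_iff₀ (by exact_mod_cast h0)] at h1
    exact h1.le
  have hjump : ∀ n ≥ max N K, ∀ j ≤ K, dist (p n) (p (n + j)) ≤ j * (2 * η * n) := by
    intro n hn j
    induction j with
    | zero => intro _; simp
    | succ j ih =>
      intro hj
      have h1 := ih (by omega)
      have h2 := hnear (n + j) (by have := le_max_left N K; omega)
      have h3 := dist_triangle (p n) (p (n + j)) (p (n + (j + 1)))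
      have h4 : ((n + j : ℕ) : ℝ) ≤ 2 * n := by
        have : n + j ≤ 2 * n := by have := le_max_right N K; omega
        exact_mod_cast this
      have h5 : η * ((n + j : ℕ) : ℝ) ≤ η * (2 * n) := by gcongr
      rw [← add_assoc] at h3 ⊢
      push_cast
      nlinarith
  have hbase : ∀ n ≥ max N K, ∀ j ≤ K,
      (A - ε) * n ≤ gromovProduct x (p n) (p (n + j)) := by
    intro n hn j hj
    have h1 := hfar n (by have := le_max_left N K; omega)
    have h2 := hfar (n + j) (by have := le_max_left N K; omega)
    have h3 := hjump n hn j hj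
    have h4 : (j : ℝ) * (2 * η * n) ≤ K * (2 * η * n) := by gcongr
    have h5 : (A - η) * (n : ℝ) ≤ (A - η) * ((n + j : ℕ) : ℝ) := by
      have : 0 ≤ A - η := by linarith
      gcongr
      omega
    have h6 : (A - ε) * (n : ℝ) = (A - η) * n - K * η * n := by rw [← hηK]; ring
    simp only [gromovProduct]
    linarith
  -- Go from n to n + d in jumps of K. The bound for the rest of the path starts at n + K, so it is
  -- already at least (A-ε)n, and the losses of κ do not accumulate.
  have hall : ∀ d : ℕ, ∀ n ≥ max N K,
      (A - ε) * n - κ ≤ gromovProduct x (p n) (p (n + d)) := by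
    intro d
    induction d using Nat.strong_induction_on with
    | _ d ih =>
      intro n hn
      rcases le_or_gt d K with hd | hd
      · linarith [hbase n hn d hd]
      · have hKpos : 0 < K := by exact_mod_cast (zero_lt_one.trans_le hK1)
        have h1 := hbase n hn K le_rfl
        have h2 := ih (d - K) (by omega) (n + K) (by omega)
        rw [show n + K + (d - K) = n + d by omega] at h2
        push_cast at h2
        exact hκ.le h1 (by linarith)
  refine ⟨max N K, fun n hn m hm => ?_⟩
  obtain ⟨d, rfl⟩ := Nat.exists_eq_add_of_le hm
  exact hall d n hn

/-- A sequence going to infinity in a proper hyperbolic space, with rate of escape `A` and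
sublinear steps, is tracked sublinearly by a geodesic ray of speed `A`. -/
theorem FourPoint.exists_ray_tracking [ProperSpace X] (hgeod : IsGeodesicSpace X) {κ : ℝ}
    (hκ : FourPoint X κ) (x : X) (p : ℕ → X) (hp : Tendsto (fun n => dist x (p n)) atTop atTop)
    {A : ℝ≥0} (hA : Tendsto (fun n : ℕ => dist x (p n) / n) atTop (𝓝 A))
    (hstep : Tendsto (fun n : ℕ => dist (p n) (p (n + 1)) / n) atTop (𝓝 0)) :
    ∃ γ : ℝ≥0 → X, Isometry γ ∧ γ 0 = x ∧
      Tendsto (fun n : ℕ => dist (p n) (γ (A * n)) / n) atTop (𝓝 0) := by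
  have : Nonempty X := ⟨x⟩
  have hκ0 := hκ.nonneg
  choose σ h0 h1 hle hiso using fun n => hgeod.exists_path x (p n)
  -- The ray is the limit of the geodesics from x to p_n along a free ultrafilter, which serves all
  -- times t at once.
  have hlim : ∀ t : ℝ≥0, ∃ a : X, Tendsto (fun n => σ n t) (hyperfilter ℕ) (𝓝 a) := fun t => by
    obtain ⟨a, -, ha⟩ := (isCompact_closedBall x (t : ℝ)).ultrafilter_le_nhds'
      ((hyperfilter ℕ).map fun n => σ n t) (by
        refine Ultrafilter.mem_map.2 (univ_mem' fun n => ?_)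
        simpa [dist_comm] using hle n t t.2)
    exact ⟨a, ha⟩
  choose γ hγ using hlim
  have hU : (hyperfilter ℕ : Filter ℕ) ≤ atTop := Nat.hyperfilter_le_atTop
  have hγ0 : γ 0 = x := tendsto_nhds_unique (hγ 0) (by simp [h0])
  have hγiso : Isometry γ := Isometry.of_dist_eq fun s t => by
    refine tendsto_nhds_unique ((hγ s).dist (hγ t)) (tendsto_const_nhds.congr' ?_)
    filter_upwards [hU (hp.eventually_ge_atTop (s : ℝ)), hU (hp.eventually_ge_atTop (t : ℝ))]
      with n hs ht
    rw [hiso n s ⟨s.2, hs⟩ t ⟨t.2, ht⟩, NNReal.dist_eq]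
  refine ⟨γ, hγiso, hγ0, ?_⟩
  -- At speed 0 the tracking point stays at x, and the claim is `hA` itself.
  rcases eq_or_ne A 0 with rfl | hA0
  · simpa [hγ0, dist_comm] using hA
  have hApos : (0 : ℝ) < A := by exact_mod_cast pos_iff_ne_zero.2 hA0
  rw [Metric.tendsto_nhds]
  intro η hη
  set ε := min (η / 8) (A / 2) with hεdef
  have hε : 0 < ε := lt_min (by linarith) (by linarith)
  have hεA : ε < A := (min_le_right _ _).trans_lt (by linarith)
  have hεη : ε ≤ η / 8 := min_le_left _ _
  obtain ⟨N, hN⟩ := hκ.linear_le_gromovProduct x p hA hstep hε hεA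
  have hlin : Tendsto (fun n : ℕ => (A - ε) * (n : ℝ)) atTop atTop :=
    tendsto_natCast_atTop_atTop.const_mul_atTop (by linarith)
  filter_upwards [eventually_ge_atTop N, eventually_gt_atTop 0, hlin.eventually_ge_atTop κ,
    hA.eventually_lt_const (show (A : ℝ) < A + η / 8 by linarith),
    tendsto_natCast_atTop_atTop.eventually_gt_atTop (24 * κ / η)] with n hn hn0 hn1 hn2 hn3
  have hn0' : (0 : ℝ) < n := by exact_mod_cast hn0
  rw [div_lt_iff₀ hn0'] at hn2
  rw [div_lt_iff₀ hη] at hn3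
  rw [Real.dist_eq, sub_zero, abs_of_nonneg (by positivity), div_lt_iff₀ hn0']
  -- Go from p_n back along its geodesic to time T, across to the ray (4κ), and forward to time An
  -- (εn + κ). The total is at most (η/8 + 2ε)n + 6κ, which is less than ηn by the choices ε ≤ η/8
  -- and n > 24κ/η.
  set T : ℝ := (A - ε) * n - κ with hT
  have hT0 : 0 ≤ T := by linarith
  have key : ∀ m ≥ n, dist (σ n T) (σ m T) ≤ 4 * κ := fun m hm => by
    have hg := hN n hn m hm
    have ⟨a, a'⟩ := path_dist (h0 n) (h1 n) (hiso n)
      ⟨hT0, hg.trans (gromovProduct_le_left _ _ _)⟩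
    have ⟨b, b'⟩ := path_dist (h0 m) (h1 m) (hiso m)
      ⟨hT0, hg.trans (gromovProduct_le_right _ _ _)⟩
    exact hκ.dist_path_le (p := p n) (q := p m) a (by linarith) b (by linarith) hg
  have hT' : (T.toNNReal : ℝ) = T := Real.coe_toNNReal T hT0
  have hTγ : dist (σ n T) (γ T.toNNReal) ≤ 4 * κ := by
    have hl := hγ T.toNNReal
    rw [hT'] at hl
    exact le_of_tendsto (tendsto_const_nhds.dist hl) (hU ((eventually_ge_atTop n).mono key))
  have hγγ : dist (γ T.toNNReal) (γ (A * n)) = ε * n + κ := by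
    rw [hγiso.dist_eq, NNReal.dist_eq]
    simp only [hT', NNReal.coe_mul, NNReal.coe_natCast]
    rw [abs_of_nonpos (by rw [hT]; nlinarith)]
    rw [hT]; ring
  obtain ⟨-, hpσ⟩ := path_dist (h0 n) (h1 n) (hiso n)
    ⟨hT0, (hN n hn n le_rfl).trans (gromovProduct_le_left _ _ _)⟩
  have t1 := dist_triangle (p n) (σ n T) (γ (A * n))
  have t2 := dist_triangle (σ n T) (γ T.toNNReal) (γ (A * n))
  rw [dist_comm (p n) (σ n T)] at t1
  have t3 : ε * n ≤ η / 8 * n := by gcongr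
  have t4 : T = A * n - ε * n - κ := by rw [hT]; ring
  linarith

end Tracking

/-! ### Finitely additive probabilities. -/

section Content

variable {X : Type*}

/-- A finitely additive probability on all subsets of `X`. -/
structure IsContent (m : Set X → ℝ) : Prop where
  nonneg : ∀ E, 0 ≤ m E
  univ : m Set.univ = 1
  union : ∀ E F, Disjoint E F → m (E ∪ F) = m E + m F

theorem IsContent.mono {m : Set X → ℝ} (hm : IsContent m) {E F : Set X} (h : E ⊆ F) :
    m E ≤ m F := by
  have := hm.union E (F \ E) Set.disjoint_sdiff_right
  rw [Set.union_sdiff_cancel h] at this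
  linarith [hm.nonneg (F \ E)]

theorem IsContent.le_one {m : Set X → ℝ} (hm : IsContent m) (E : Set X) : m E ≤ 1 :=
  hm.univ ▸ hm.mono (Set.subset_univ E)

theorem IsContent.empty {m : Set X → ℝ} (hm : IsContent m) : m ∅ = 0 := by
  simpa using hm.union ∅ ∅ (Set.disjoint_empty _)

theorem IsContent.compl {m : Set X → ℝ} (hm : IsContent m) (E : Set X) : m Eᶜ = 1 - m E := by
  have := hm.union E Eᶜ disjoint_compl_right
  rw [Set.union_compl_self, hm.univ] at this
  linarith

theorem IsContent.nonempty_inter {m : Set X → ℝ} (hm : IsContent m) {E F : Set X}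
    (h : 1 < m E + m F) : (E ∩ F).Nonempty := by
  by_contra hE
  have := hm.union E F (Set.disjoint_iff_inter_eq_empty.2 (Set.not_nonempty_iff_eq_empty.1 hE))
  linarith [hm.le_one (E ∪ F)]

theorem IsContent.nonempty {m : Set X → ℝ} (hm : IsContent m) {E : Set X} (h : 0 < m E) :
    E.Nonempty := by
  have := hm.nonempty_inter (E := E) (F := Set.univ) (by rw [hm.univ]; linarith)
  simpa using this

theorem IsContent.sum_le_one {m : Set X → ℝ} (hm : IsContent m) {ι : Type*} (t : Finset ι)
    (E : ι → Set X) (h : ∀ i ∈ t, ∀ j ∈ t, i ≠ j → Disjoint (E i) (E j)) :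
    ∑ i ∈ t, m (E i) ≤ 1 := by
  classical
  have key : ∑ i ∈ t, m (E i) = m (⋃ i ∈ t, E i) := by
    induction t using Finset.induction_on with
    | empty => simp [hm.empty]
    | insert a t ha ih =>
      rw [Finset.sum_insert ha, Finset.set_biUnion_insert, hm.union,
        ih fun i hi j hj => h i (Finset.mem_insert_of_mem hi) j (Finset.mem_insert_of_mem hj)]
      simp only [Set.disjoint_iUnion_right]
      exact fun i hi => h a (Finset.mem_insert_self a t) i (Finset.mem_insert_of_mem hi)
        (fun e => ha (e ▸ hi))
  exact key ▸ hm.le_one _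

theorem IsContent.summable {G : Type*} {w : G → ℝ} (hw0 : ∀ g, 0 ≤ w g) (hw : HasSum w 1) {m : Set X → ℝ}
    (hm : IsContent m) (E : G → Set X) : Summable fun g => w g * m (E g) :=
  hw.summable.of_nonneg_of_le (fun g => mul_nonneg (hw0 g) (hm.nonneg _))
    fun g => mul_le_of_le_one_right (hw0 g) (hm.le_one _)

end Content

/-! ### A stationary finitely additive probability. -/

section Stationary

variable {G X : Type*} [Group G] [MulAction G X]

/-- The convolution of the weights `w` with a finitely additive probability. -/
noncomputable def convContent (w : G → ℝ) (m : Set X → ℝ) (E : Set X) : ℝ :=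
  ∑' g, w g * m ((g • ·) ⁻¹' E)

theorem IsContent.conv {w : G → ℝ} (hw0 : ∀ g, 0 ≤ w g) (hw : HasSum w 1) {m : Set X → ℝ}
    (hm : IsContent m) : IsContent (convContent w m) where
  nonneg E := tsum_nonneg fun g => mul_nonneg (hw0 g) (hm.nonneg _)
  univ := by simp [convContent, hm.univ, hw.tsum_eq]
  union E F h := by
    simp only [convContent]
    rw [← (hm.summable hw0 hw _).tsum_add (hm.summable hw0 hw _)]
    congr 1; ext g
    rw [Set.preimage_union, hm.union _ _ (h.preimage _), mul_add]

/-- Existence of a finitely additive stationary probability. -/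
theorem exists_stationary_content [Nonempty X] {w : G → ℝ} (hw0 : ∀ g, 0 ≤ w g)
    (hw : HasSum w 1) :
    ∃ m : Set X → ℝ, IsContent m ∧ ∀ E, m E = ∑' g, w g * m ((g • ·) ⁻¹' E) := by
  classical
  obtain ⟨o⟩ := ‹Nonempty X›
  set ν : ℕ → Set X → ℝ := fun k => (convContent w)^[k] fun E => if o ∈ E then 1 else 0 with hν
  have hνs : ∀ k, ν (k + 1) = convContent w (ν k) := fun k => by
    simp only [hν, Function.iterate_succ_apply']
  have hνc : ∀ k, IsContent (ν k) := by
    intro k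
    induction k with
    | zero =>
      refine ⟨fun E => ?_, ?_, fun E F h => ?_⟩ <;> simp only [hν, Function.iterate_zero_apply]
      · split_ifs <;> norm_num
      · simp
      · by_cases h1 : o ∈ E <;> by_cases h2 : o ∈ F <;> simp [h1, h2]
        exact Set.disjoint_left.1 h h1 h2
    | succ k ih => rw [hνs]; exact ih.conv hw0 hw
  -- Krylov–Bogolyubov: Cesàro averages of the iterated convolutions of a Dirac mass are stationary
  -- up to O(1/n). An ultrafilter limit, taken on every set at once, preserves finite additivity.
  set c : ℕ → Set X → ℝ := fun n E => (∑ k ∈ Finset.range (n + 1), ν k E) / (n + 1) with hc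
  have hcc : ∀ n, IsContent (c n) := fun n => by
    refine ⟨fun E => ?_, ?_, fun E F h => ?_⟩ <;> simp only [hc]
    · exact div_nonneg (Finset.sum_nonneg fun k _ => (hνc k).nonneg E) (by positivity)
    · simp only [(hνc _).univ, Finset.sum_const, Finset.card_range, nsmul_eq_mul, mul_one]
      push_cast
      exact div_self (by positivity)
    · simp only [(hνc _).union E F h, Finset.sum_add_distrib, add_div]
  have hconv : ∀ n E, convContent w (c n) E = c n E + (ν (n + 1) E - ν 0 E) / (n + 1) := by
    intro n E
    have h1 : convContent w (c n) E = (∑ k ∈ Finset.range (n + 1), ν (k + 1) E) / (n + 1) := by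
      simp only [hνs, convContent]
      rw [← Summable.tsum_finsetSum fun k _ => (hνc k).summable hw0 hw _, ← tsum_div_const]
      congr 1; ext g
      simp only [hc]
      rw [← Finset.mul_sum, mul_div_assoc]
    rw [h1, hc, ← add_div]
    congr 1
    have := Finset.sum_range_succ (fun k => ν k E) (n + 1)
    rw [Finset.sum_range_succ'] at this
    linarith
  have hlim : ∀ E, ∃ a, Tendsto (fun n => c n E) (hyperfilter ℕ) (𝓝 a) := fun E => by
    obtain ⟨a, -, ha⟩ := (isCompact_Icc (a := (0 : ℝ)) (b := 1)).ultrafilter_le_nhds'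
      ((hyperfilter ℕ).map fun n => c n E)
      (Ultrafilter.mem_map.2 (univ_mem' fun n => ⟨(hcc n).nonneg E, (hcc n).le_one E⟩))
    exact ⟨a, ha⟩
  choose m hm using hlim
  have hmc : IsContent m := by
    refine ⟨fun E => ?_, ?_, fun E F h => ?_⟩
    · exact ge_of_tendsto' (hm E) fun n => (hcc n).nonneg E
    · refine tendsto_nhds_unique (hm _) ?_
      simp only [(hcc _).univ]
      exact tendsto_const_nhds
    · refine tendsto_nhds_unique (hm _) ?_
      simp only [(hcc _).union E F h]
      exact (hm E).add (hm F)
  refine ⟨m, hmc, fun E => ?_⟩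
  -- The weights are summable and contents are at most 1, so the limit passes through the sum over G
  -- by dominated convergence.
  have h1 : Tendsto (fun n => convContent w (c n) E) (hyperfilter ℕ)
      (𝓝 (∑' g, w g * m ((g • ·) ⁻¹' E))) := by
    refine tendsto_tsum_of_dominated_convergence hw.summable
      (fun g => (hm _).const_mul (w g)) (Eventually.of_forall fun n g => ?_)
    rw [Real.norm_of_nonneg (mul_nonneg (hw0 g) ((hcc n).nonneg _))]
    exact mul_le_of_le_one_right (hw0 g) ((hcc n).le_one _)
  refine tendsto_nhds_unique ?_ h1
  have h2 : Tendsto (fun n : ℕ => (ν (n + 1) E - ν 0 E) / ((n : ℝ) + 1)) atTop (𝓝 0) := by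
    refine squeeze_zero_norm (fun n => ?_) tendsto_one_div_add_atTop_nhds_zero_nat
    rw [norm_div, Real.norm_eq_abs, Real.norm_of_nonneg (by positivity)]
    gcongr
    rw [abs_le]
    constructor <;> linarith [(hνc (n + 1)).nonneg E, (hνc (n + 1)).le_one E, (hνc 0).nonneg E,
      (hνc 0).le_one E]
  simpa only [hconv, add_zero] using (hm E).add (h2.mono_left Nat.hyperfilter_le_atTop)

end Stationary

/-! ### Absence of atoms at infinity, and small shadows. -/

section Atoms

variable {X : Type*} [MetricSpace X]

/-- The points of `X` whose Gromov product with a sequence is eventually at least `R`. -/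
def seqNhd (o : X) (u : ℕ → X) (R : ℝ) : Set X :=
  {z | ∀ᶠ n in atTop, R ≤ gromovProduct o (u n) z}

theorem seqNhd_anti (o : X) (u : ℕ → X) {R S : ℝ} (h : R ≤ S) : seqNhd o u S ⊆ seqNhd o u R :=
  fun _ hz => hz.mono fun _ hn => h.trans hn

theorem GromovAsymptotic.symm {u v : ℕ → X} (h : GromovAsymptotic u v) : GromovAsymptotic v u := by
  refine (gromovAsymptotic_iff (u 0)).2 fun R => ?_
  obtain ⟨N, hN⟩ := (gromovAsymptotic_iff (u 0)).1 h R
  exact ⟨N, fun n hn m hm => by rw [gromovProduct_comm]; exact hN m hm n hn⟩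

theorem GromovAsymptotic.seqNhd_subset {κ : ℝ} (hκ : FourPoint X κ) (o : X) {u v : ℕ → X}
    (h : GromovAsymptotic u v) (R : ℝ) : seqNhd o u R ⊆ seqNhd o v (R - κ) := by
  intro z hz
  obtain ⟨N, hN⟩ := (gromovAsymptotic_iff o).1 h.symm R
  obtain ⟨n, hn, hn'⟩ := (hz.and (eventually_ge_atTop N)).exists
  filter_upwards [eventually_ge_atTop N] with k hk
  exact hκ.le (hN k hk n hn') hn

/-- If the neighbourhoods met for every R, a common point would link the two sequences through the
four point condition and make them asymptotic. -/
theorem exists_disjoint_seqNhd {κ : ℝ} (hκ : FourPoint X κ) (o : X) {u v : ℕ → X}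
    (h : ¬ GromovAsymptotic u v) : ∃ R : ℝ, Disjoint (seqNhd o u R) (seqNhd o v R) := by
  by_contra! hR
  refine h ((gromovAsymptotic_iff o).2 fun R => ?_)
  obtain ⟨z, hzu, hzv⟩ := Set.not_disjoint_iff.1 (hR (R + κ))
  obtain ⟨N, hN⟩ := eventually_atTop.1 (Filter.Eventually.and hzu hzv)
  refine ⟨N, fun n hn m hm => ?_⟩
  have := hκ.le (hN n hn).1 (by rw [gromovProduct_comm]; exact (hN m hm).2)
  linarith

/-- The mass that `m` gives to the point at infinity of a sequence. -/
noncomputable def seqMass (m : Set X → ℝ) (o : X) (u : ℕ → X) : ℝ :=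
  ⨅ R : ℕ, m (seqNhd o u R)

theorem IsContent.bddBelow_range {m : Set X → ℝ} (hm : IsContent m) (o : X) (u : ℕ → X) :
    BddBelow (Set.range fun R : ℕ => m (seqNhd o u R)) :=
  ⟨0, by rintro _ ⟨R, rfl⟩; exact hm.nonneg _⟩

theorem IsContent.seqMass_le {m : Set X → ℝ} (hm : IsContent m) (o : X) (u : ℕ → X) (R : ℝ) :
    seqMass m o u ≤ m (seqNhd o u R) := by
  obtain ⟨k, hk⟩ := exists_nat_ge R
  exact (ciInf_le (hm.bddBelow_range o u) k).trans (hm.mono (seqNhd_anti o u hk))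

theorem IsContent.seqMass_congr {κ : ℝ} (hκ : FourPoint X κ) {m : Set X → ℝ} (hm : IsContent m)
    (o : X) {u v : ℕ → X} (h : GromovAsymptotic u v) : seqMass m o u = seqMass m o v := by
  have key : ∀ u v : ℕ → X, GromovAsymptotic u v → seqMass m o u ≤ seqMass m o v :=
    fun u v h => le_ciInf fun R => (hm.seqMass_le o u (R + κ)).trans <| hm.mono <| by
      simpa using h.seqNhd_subset hκ o (R + κ)
  exact le_antisymm (key u v h) (key v u h.symm)

/-- The mass that `m` gives to a boundary point. -/
noncomputable def boundaryMass {κ : ℝ} (hκ : FourPoint X κ) {m : Set X → ℝ} (hm : IsContent m)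
    (o : X) : Boundary X → ℝ :=
  Quot.lift (fun u => seqMass m o u.1) fun _ _ h => hm.seqMass_congr hκ o h

/-- More than 1/ε such boundary points would have pairwise disjoint neighbourhoods for a common
large R, each of mass at least ε. -/
theorem finite_boundaryMass_ge {κ : ℝ} (hκ : FourPoint X κ) {m : Set X → ℝ} (hm : IsContent m)
    (o : X) {ε : ℝ} (hε : 0 < ε) : {ξ | ε ≤ boundaryMass hκ hm o ξ}.Finite := by
  by_contra hinf
  obtain ⟨k, hk⟩ := exists_nat_gt (1 / ε)
  obtain ⟨t, ht, rfl⟩ := Set.Infinite.exists_subset_card_eq hinf k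
  choose rep hrep using fun ξ : Boundary X => Quot.exists_rep ξ
  have hdis : ∀ᶠ R : ℝ in atTop, ∀ ξ ∈ t, ∀ η ∈ t, ξ ≠ η →
      Disjoint (seqNhd o (rep ξ).1 R) (seqNhd o (rep η).1 R) := by
    simp only [Filter.eventually_all_finset]
    intro ξ _ η _
    by_cases hne : ξ = η
    · exact Eventually.of_forall fun _ h => absurd hne h
    · have : ¬ GromovAsymptotic (rep ξ).1 (rep η).1 := fun h => hne <| by
        rw [← hrep ξ, ← hrep η]; exact Quot.sound h
      obtain ⟨R, hR⟩ := exists_disjoint_seqNhd hκ o this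
      filter_upwards [eventually_ge_atTop R] with S hS _
      exact hR.mono (seqNhd_anti o _ hS) (seqNhd_anti o _ hS)
  obtain ⟨R, hR⟩ := hdis.exists
  have h1 := hm.sum_le_one t (fun ξ => seqNhd o (rep ξ).1 R) hR
  have h2 : ∀ ξ ∈ t, ε ≤ m (seqNhd o (rep ξ).1 R) := fun ξ hξ => by
    have : ε ≤ boundaryMass hκ hm o ξ := ht hξ
    rw [← hrep ξ] at this
    exact this.trans (hm.seqMass_le o _ R)
  have h3 := Finset.card_nsmul_le_sum t _ ε h2
  rw [nsmul_eq_mul] at h3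
  rw [div_lt_iff₀ hε] at hk
  linarith

variable {G : Type*} [Group G] [MulAction G X] [IsIsometricSMul G X]

theorem preimage_smul_seqNhd (g : G) (o : X) (u : ℕ → X) (R : ℝ) :
    (g • ·) ⁻¹' seqNhd o u R ⊆ seqNhd o (fun n => g⁻¹ • u n) (R - dist (g⁻¹ • o) o) := by
  intro z hz
  refine Filter.Eventually.mono hz fun n (hn : R ≤ gromovProduct o (u n) (g • z)) => ?_
  rw [gromovProduct_comm, gromovProduct_smul, gromovProduct_comm] at hn
  linarith [gromovProduct_le_add_base (g⁻¹ • o) o (g⁻¹ • u n) z]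

/-- Stationarity applied to shrinking neighbourhoods, with dominated convergence over G. Translation
by g changes the radius by at most the distance from g⁻¹ o to o, which disappears in the limit. This
subharmonic inequality is what the maximum principle needs. -/
theorem boundaryMass_le_tsum {κ : ℝ} (hκ : FourPoint X κ) {m : Set X → ℝ} (hm : IsContent m)
    {w : G → ℝ} (hw0 : ∀ g, 0 ≤ w g) (hw : HasSum w 1)
    (hstat : ∀ E, m E = ∑' g, w g * m ((g • ·) ⁻¹' E)) (o : X) (ξ : Boundary X) :
    boundaryMass hκ hm o ξ ≤ ∑' g, w g * boundaryMass hκ hm o (g⁻¹ • ξ) := by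
  obtain ⟨u, rfl⟩ : ∃ u, Boundary.mk u = ξ := Quot.exists_rep ξ
  have hlim : ∀ g : G, Tendsto (fun R : ℕ => m ((g • ·) ⁻¹' seqNhd o u.1 (R : ℝ))) atTop
      (𝓝 (⨅ R : ℕ, m ((g • ·) ⁻¹' seqNhd o u.1 (R : ℝ)))) := fun g =>
    tendsto_atTop_ciInf (fun R S h => hm.mono (Set.preimage_mono
      (seqNhd_anti o u.1 (by exact_mod_cast h)))) ⟨0, by rintro _ ⟨R, rfl⟩; exact hm.nonneg _⟩
  have hle : ∀ g : G, (⨅ R : ℕ, m ((g • ·) ⁻¹' seqNhd o u.1 (R : ℝ))) ≤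
      boundaryMass hκ hm o (g⁻¹ • Boundary.mk u) := fun g => by
    refine le_ciInf fun R => ?_
    obtain ⟨k, hk⟩ := exists_nat_ge (R + dist (g⁻¹ • o) o)
    refine (ciInf_le ⟨0, by rintro _ ⟨R, rfl⟩; exact hm.nonneg _⟩ k).trans (hm.mono ?_)
    exact (preimage_smul_seqNhd g o u.1 k).trans (seqNhd_anti o _ (by linarith))
  have h0 : ∀ ξ, 0 ≤ boundaryMass hκ hm o ξ := by
    rintro ⟨v⟩; exact Real.iInf_nonneg fun R => hm.nonneg _
  have h1 : ∀ ξ, boundaryMass hκ hm o ξ ≤ 1 := by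
    rintro ⟨v⟩; exact (hm.seqMass_le o v.1 0).trans (hm.le_one _)
  have hdom := tendsto_tsum_of_dominated_convergence hw.summable
    (fun g => (hlim g).const_mul (w g)) (Eventually.of_forall fun R g => by
      rw [Real.norm_of_nonneg (mul_nonneg (hw0 g) (hm.nonneg _))]
      exact mul_le_of_le_one_right (hw0 g) (hm.le_one _))
  refine (ge_of_tendsto' hdom fun R => ?_).trans (Summable.tsum_le_tsum
    (fun g => mul_le_mul_of_nonneg_left (hle g) (hw0 g)) ?_ ?_)
  · rw [← hstat]; exact hm.seqMass_le o u.1 R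
  · refine hw.summable.of_nonneg_of_le
      (fun g => mul_nonneg (hw0 g) (Real.iInf_nonneg fun R => hm.nonneg _))
      fun g => mul_le_of_le_one_right (hw0 g) ((hle g).trans (h1 _))
  · exact hw.summable.of_nonneg_of_le (fun g => mul_nonneg (hw0 g) (h0 _))
      fun g => mul_le_of_le_one_right (hw0 g) (h1 _)

/-- A stationary finitely additive probability for a non-elementary walk has no atoms at
infinity. -/
theorem boundaryMass_eq_zero {κ : ℝ} (hκ : FourPoint X κ) {m : Set X → ℝ} (hm : IsContent m)
    {w : G → ℝ} (hw0 : ∀ g, 0 ≤ w g) (hw : HasSum w 1)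
    (hstat : ∀ E, m E = ∑' g, w g * m ((g • ·) ⁻¹' E))
    (hne : ¬ IsElementary X (Subgroup.closure {g | w g ≠ 0})) (o : X) (ξ : Boundary X) :
    boundaryMass hκ hm o ξ ≤ 0 := by
  by_contra! hε
  set b := boundaryMass hκ hm o with hb
  have hfin : {η | b ξ ≤ b η}.Finite := finite_boundaryMass_ge hκ hm o hε
  obtain ⟨ζ, hζ, hmax⟩ := Set.exists_max_image _ b hfin ⟨ξ, le_refl (b ξ)⟩
  have hmax' : ∀ η, b η ≤ b ζ := fun η => by
    rcases le_total (b ξ) (b η) with h | h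
    · exact hmax η h
    · exact h.trans hζ
  set S := {η | b η = b ζ} with hS
  have hSfin : S.Finite := hfin.subset fun η (h : b η = b ζ) => by
    change b ξ ≤ b η; rw [h]; exact hζ
  have h0 : ∀ η, 0 ≤ b η := by
    rintro ⟨v⟩; exact Real.iInf_nonneg fun R => hm.nonneg _
  -- Maximum principle: the maximum is bounded by an average of values no larger than it, so every g
  -- of positive weight pulls the maximal set S back into itself. As S is finite, it is then
  -- invariant under the generated subgroup.
  have hpull : ∀ g : G, w g ≠ 0 → ∀ η ∈ S, g⁻¹ • η ∈ S := by
    intro g hg η hη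
    by_contra hlt
    have hlt' : b (g⁻¹ • η) < b ζ := lt_of_le_of_ne (hmax' _) hlt
    have h1 := boundaryMass_le_tsum hκ hm hw0 hw hstat o η
    have hs : HasSum (fun g => w g * b ζ) (b ζ) := by simpa using hw.mul_right (b ζ)
    have h2 : ∑' g, w g * b (g⁻¹ • η) < ∑' g, w g * b ζ := by
      refine Summable.tsum_lt_tsum (i := g)
        (fun g => mul_le_mul_of_nonneg_left (hmax' _) (hw0 g)) ?_ ?_ hs.summable
      · exact mul_lt_mul_of_pos_left hlt' (lt_of_le_of_ne (hw0 g) hg.symm)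
      · exact hs.summable.of_nonneg_of_le (fun g => mul_nonneg (hw0 g) (h0 _))
          fun g => mul_le_mul_of_nonneg_left (hmax' _) (hw0 g)
    rw [hs.tsum_eq] at h2
    have h3 : b η = b ζ := hη
    rw [← hb] at h1
    linarith
  have hstab : ∀ g : G, w g ≠ 0 → (fun η => g⁻¹ • η) '' S = S := fun g hg => by
    refine Set.eq_of_subset_of_ncard_le ?_ ?_ hSfin
    · rintro _ ⟨η, hη, rfl⟩; exact hpull g hg η hη
    · rw [Set.ncard_image_of_injective _ (MulAction.injective g⁻¹)]
  refine hne ⟨S, hSfin, ⟨ζ, rfl⟩, fun h hh => ?_⟩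
  induction hh using Subgroup.closure_induction with
  | mem g hg =>
    conv_lhs => rw [← hstab g hg, Set.image_image]
    simp
  | one => simp
  | mul x y _ _ hx hy =>
    conv_rhs => rw [← hx, ← hy, Set.image_image]
    simp only [mul_smul]
  | inv x _ hx =>
    conv_lhs => rw [← hx, Set.image_image]
    simp

/-- A stationary finitely additive probability of a non-elementary walk gives uniformly small
mass to small shadows. -/
theorem exists_shadow_le [ProperSpace X] (hgeod : IsGeodesicSpace X) {κ : ℝ}
    (hκ : FourPoint X κ) {m : Set X → ℝ} (hm : IsContent m)
    {w : G → ℝ} (hw0 : ∀ g, 0 ≤ w g) (hw : HasSum w 1)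
    (hstat : ∀ E, m E = ∑' g, w g * m ((g • ·) ⁻¹' E))
    (hne : ¬ IsElementary X (Subgroup.closure {g | w g ≠ 0})) (o : X) {ε : ℝ} (hε : 0 < ε) :
    ∃ T : ℝ, ∀ p : X, m {z | T ≤ gromovProduct o z p} ≤ ε := by
  by_contra! hcon
  -- If the bound fails, shadows of depth n with mass above ε exist for all n. Their centres p_n go
  -- to infinity, and the limit of a Gromov subsequence would be an atom of mass at least ε.
  choose p hp using fun n : ℕ => hcon n
  have hfar : Tendsto (fun n => dist o (p n)) atTop atTop := by
    refine tendsto_atTop_mono (fun n => ?_) tendsto_natCast_atTop_atTop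
    obtain ⟨z, hz⟩ := hm.nonempty (hε.trans (hp n))
    exact le_trans hz (gromovProduct_le_right o z (p n))
  obtain ⟨φ, hφ, hG⟩ := exists_gromov_subseq hgeod o hfar
  have hatom := boundaryMass_eq_zero hκ hm hw0 hw hstat hne o (Quot.mk _ ⟨_, hG⟩)
  refine absurd (hε.trans_le (le_ciInf fun R : ℕ => ?_)) hatom.not_gt
  obtain ⟨N, hN⟩ := (gromovAsymptotic_iff o).1 hG (R + κ)
  obtain ⟨n, hn, hn'⟩ := ((eventually_ge_atTop N).and
    ((tendsto_natCast_atTop_atTop.comp hφ.tendsto_atTop).eventually_ge_atTop (R + κ))).exists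
  refine (hp (φ n)).le.trans (hm.mono fun z hz => ?_)
  filter_upwards [eventually_ge_atTop N] with k hk
  have hz' : (R : ℝ) + κ ≤ gromovProduct o (p (φ n)) z := by
    rw [gromovProduct_comm]; exact le_trans hn' hz
  have := hκ.le (hN k hk n hn) hz'
  linarith

end Atoms

/-! ### From converging translates of the content to convergence of the path. -/

section Convergence

variable {G X : Type*} [Group G] [MetricSpace X] [MulAction G X] [IsIsometricSMul G X]

/-- If small shadows have small mass, then far translates of `m` concentrate near the
corresponding orbit point. -/
theorem IsContent.concentrate {m : Set X → ℝ} (hm : IsContent m) (o : X) {ε T : ℝ}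
    (hT : ∀ p : X, m {z | T ≤ gromovProduct o z p} ≤ ε) (R : ℝ) {g : G}
    (hg : T + R ≤ dist o (g • o)) :
    1 - ε ≤ m {z | R ≤ gromovProduct o (g • z) (g • o)} := by
  have hsub : {z | R ≤ gromovProduct o (g • z) (g • o)}ᶜ ⊆
      {z | T ≤ gromovProduct o z (g⁻¹ • o)} := by
    intro z hz
    simp only [Set.mem_compl_iff, Set.mem_ofPred_eq, not_le] at hz ⊢
    rw [gromovProduct_smul, inv_smul_smul] at hz
    -- The products (z,o) seen from g⁻¹ o and (z, g⁻¹ o) seen from o add up to d(o, g o) ≥ T + R; if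
    -- the first is below R, the second exceeds T.
    have h1 := gromovProduct_add_gromovProduct o (g⁻¹ • o) z
    have h2 : dist o (g⁻¹ • o) = dist o (g • o) := by
      rw [← dist_smul g o, smul_inv_smul, dist_comm]
    linarith
  have := (hm.mono hsub).trans (hT _)
  rw [hm.compl] at this
  linarith

/-- Convergence to the boundary of an unbounded path along which translates of `m` converge. -/
theorem gromovAsymptotic_of_tendsto_content [ProperSpace X] (hgeod : IsGeodesicSpace X) {κ : ℝ}
    (hκ : FourPoint X κ) {m : Set X → ℝ} (hm : IsContent m) (o : X)
    (hshadow : ∀ ε > 0, ∃ T : ℝ, ∀ p : X, m {z | T ≤ gromovProduct o z p} ≤ ε)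
    (h : ℕ → G)
    (hlim : ∀ (g : G) (R : ℕ), ∃ c, Tendsto
      (fun n => m {z | (R : ℝ) ≤ gromovProduct o (h n • z) (g • o)}) atTop (𝓝 c))
    (hunb : ∀ C : ℝ, ∃ n, C ≤ dist o (h n • o)) :
    GromovAsymptotic (fun n => h n • o) (fun n => h n • o) := by
  obtain ⟨T₁, hT₁⟩ := hshadow (1 / 4) (by norm_num)
  obtain ⟨T₂, hT₂⟩ := hshadow (1 / 2) (by norm_num)
  have hfreq : ∀ k : ℕ, ∃ᶠ n in atTop, (k : ℝ) ≤ dist o (h n • o) := by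
    intro k hk
    obtain ⟨N, hN⟩ := eventually_atTop.1 hk
    obtain ⟨n, hn⟩ := hunb (k + ∑ i ∈ Finset.range N, dist o (h i • o) + 1)
    have hs : 0 ≤ ∑ i ∈ Finset.range N, dist o (h i • o) :=
      Finset.sum_nonneg fun _ _ => dist_nonneg
    have hk0 : (0 : ℝ) ≤ k := k.cast_nonneg
    rcases lt_or_ge n N with hlt | hge
    · have := Finset.single_le_sum (f := fun i => dist o (h i • o))
        (fun _ _ => dist_nonneg) (Finset.mem_range.2 hlt)
      linarith
    · exact hN n hge (by linarith)
  obtain ⟨ψ, hψ, hψfar⟩ := extraction_forall_of_frequently hfreq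
  have hfar : Tendsto (fun n => dist o (h (ψ n) • o)) atTop atTop :=
    tendsto_atTop_mono hψfar tendsto_natCast_atTop_atTop
  obtain ⟨φ, hφ, hG⟩ := exists_gromov_subseq hgeod o hfar
  have hkt : Tendsto (ψ ∘ φ) atTop atTop := hψ.tendsto_atTop.comp hφ.tendsto_atTop
  -- On the Gromov subsequence the translates give mass at least 3/4 to the shadow of one fixed
  -- orbit point. The masses converge along the full sequence, so its limit is also at least 3/4 and
  -- the mass eventually exceeds 1/2.
  have hacc : ∀ R : ℕ, ∃ g : G, ∀ᶠ n in atTop,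
      1 / 2 < m {z | (R : ℝ) ≤ gromovProduct o (h n • z) (g • o)} := by
    intro R
    obtain ⟨N, hN⟩ := (gromovAsymptotic_iff o).1 hG (R + κ)
    refine ⟨h (ψ (φ N)), ?_⟩
    obtain ⟨c, hc⟩ := hlim (h (ψ (φ N))) R
    have hge : 3 / 4 ≤ c := by
      refine ge_of_tendsto (hc.comp hkt) ?_
      filter_upwards [eventually_ge_atTop N,
        (hfar.comp hφ.tendsto_atTop).eventually_ge_atTop (T₁ + (R + κ))] with n hn hd
      refine le_trans ?_ ((hm.concentrate o hT₁ (R + κ) hd).trans (hm.mono fun z hz => ?_))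
      · norm_num
      · have := hκ.le hz (hN n hn N le_rfl)
        simpa using this
    exact hc.eventually_const_lt (by linarith)
  -- If h_n o stayed within C of o, pulling back by h_n would turn this into a shadow of depth T₂
  -- with mass above 1/2, against the choice of T₂.
  have hinf : Tendsto (fun n => dist o (h n • o)) atTop atTop := by
    refine tendsto_atTop.2 fun C => ?_
    obtain ⟨R, hR⟩ := exists_nat_ge (T₂ + C)
    obtain ⟨g, hg⟩ := hacc R
    filter_upwards [hg] with n hn
    by_contra! hlt
    refine absurd (hn.trans_le ((hm.mono fun z hz => ?_).trans (hT₂ ((h n)⁻¹ • g • o))))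
      (lt_irrefl _)
    simp only [Set.mem_ofPred_eq] at hz ⊢
    rw [gromovProduct_smul] at hz
    have h1 := gromovProduct_le_add_base ((h n)⁻¹ • o) o z ((h n)⁻¹ • g • o)
    have h2 : dist ((h n)⁻¹ • o) o = dist o (h n • o) := by
      rw [← dist_smul (h n), smul_inv_smul]
    linarith
  refine (gromovAsymptotic_iff o).2 fun R => ?_
  obtain ⟨R', hR'⟩ := exists_nat_ge (R + 2 * κ)
  obtain ⟨g, hg⟩ := hacc R'
  -- Sets of mass at least 3/4 and above 1/2 intersect; a common point z makes h_n z close both to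
  -- h_n o and to the fixed g o in the sense of Gromov products.
  have hnear : ∀ᶠ n in atTop, R' - κ ≤ gromovProduct o (h n • o) (g • o) := by
    filter_upwards [hg, hinf.eventually_ge_atTop (T₁ + R')] with n hn hd
    have h1 := hm.concentrate o hT₁ R' hd
    have h2 : 1 < m {z | (R' : ℝ) ≤ gromovProduct o (h n • z) (h n • o)} +
        m {z | (R' : ℝ) ≤ gromovProduct o (h n • z) (g • o)} := by linarith
    obtain ⟨z, hz1, hz2⟩ := hm.nonempty_inter h2
    exact hκ.le (by rw [gromovProduct_comm]; exact hz1) hz2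
  obtain ⟨N, hN⟩ := eventually_atTop.1 hnear
  refine ⟨N, fun n hn k hk => ?_⟩
  have := hκ.le (hN n hn) (by rw [gromovProduct_comm]; exact hN k hk)
  linarith

end Convergence

/-! ### Unbounded orbits: from the group to the semigroup. -/

section Semigroup

variable {G X : Type*} [Group G] [MetricSpace X] [MulAction G X] [IsIsometricSMul G X]

/-- If a subgroup generated by `s` has an unbounded orbit, so has the semigroup generated
by `s`. -/
theorem exists_mem_submonoid_closure_dist_ge [ProperSpace X] {s : Set G} {o : X}
    (hunb : ¬ Bornology.IsBounded (MulAction.orbit (Subgroup.closure s) o)) (C : ℝ) :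
    ∃ g ∈ Submonoid.closure s, C ≤ dist o (g • o) := by
  by_contra! hbd
  -- A bounded semigroup orbit is relatively compact, hence recurrent, which makes inverses
  -- approximable by positive powers and so bounds the group orbit.
  have happrox : ∀ g ∈ Subgroup.closure s, ∀ ε > 0, ∃ t ∈ Submonoid.closure s,
      dist (g • o) (t • o) ≤ ε := by
    intro g hg
    induction hg using Subgroup.closure_induction_left with
    | one => exact fun ε hε => ⟨1, one_mem _, by simpa using hε.le⟩
    | mul_left a ha y hy ih =>
      intro ε hε
      obtain ⟨t, ht, hd⟩ := ih ε hε
      exact ⟨a * t, mul_mem (Submonoid.subset_closure ha) ht, by simpa [mul_smul] using hd⟩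
    | inv_mul_cancel a ha y hy ih =>
      intro ε hε
      obtain ⟨t, ht, hd⟩ := ih (ε / 2) (by linarith)
      have haS : a ∈ Submonoid.closure s := Submonoid.subset_closure ha
      obtain ⟨q, -, φ, hφ, hlim⟩ := (isCompact_closedBall o C).tendsto_subseq
        (x := fun k : ℕ => (a ^ k * t) • o) (fun k => by
          rw [Metric.mem_closedBall, dist_comm]
          exact (hbd _ (mul_mem (pow_mem haS k) ht)).le)
      obtain ⟨N, hN⟩ := Metric.cauchySeq_iff.1 hlim.cauchySeq (ε / 2) (by linarith)
      have h1 := (hN N le_rfl (N + 1) (by omega)).le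
      -- The two nearby powers of a differ by j + 1. Cancelling the smaller power and one further a
      -- shows that a⁻¹ t o is close to a^j t o.
      obtain ⟨j, hj⟩ := Nat.exists_eq_add_of_lt (hφ (Nat.lt_succ_self N))
      refine ⟨a ^ j * t, mul_mem (pow_mem haS j) ht, ?_⟩
      simp only [Function.comp, Nat.succ_eq_add_one] at h1 hj
      rw [hj, show φ N + j + 1 = φ N + (1 + j) by ring, pow_add, mul_assoc, mul_smul (a ^ φ N),
        mul_smul (a ^ φ N), dist_smul, pow_add, pow_one, mul_assoc, mul_smul a] at h1
      have h2 : dist ((a⁻¹ * y) • o) (a⁻¹ • t • o) ≤ ε / 2 := by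
        rw [mul_smul, dist_smul]; exact hd
      have h3 : dist (a⁻¹ • t • o) ((a ^ j * t) • o) ≤ ε / 2 := by
        rw [← dist_smul a, smul_inv_smul]; exact h1
      linarith [dist_triangle ((a⁻¹ * y) • o) (a⁻¹ • t • o) ((a ^ j * t) • o)]
  refine hunb ((Metric.isBounded_closedBall (x := o) (r := C + 1)).subset ?_)
  rintro _ ⟨⟨g, hg⟩, rfl⟩
  obtain ⟨t, ht, hd⟩ := happrox g hg 1 one_pos
  have h1 := hbd t ht
  rw [Metric.mem_closedBall]
  change dist (g • o) o ≤ C + 1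
  have := dist_triangle (g • o) (t • o) o
  rw [dist_comm (t • o) o] at this
  linarith

end Semigroup

open ProbabilityTheory

/-! ### Walks, independence and the strong law for blocks. -/

section WalkLemmas

variable {G : Type*} [Group G]

theorem walk_add (ω : ℕ → G) (n m : ℕ) :
    walk ω (n + m) = walk ω n * walk (fun i => ω (i + n)) m := by
  induction m with
  | zero => simp [walk]
  | succ m ih => rw [← add_assoc, walk, ih, walk, mul_assoc, add_comm n m]

theorem walk_congr {ω ω' : ℕ → G} {n : ℕ} (h : ∀ i < n, ω i = ω' i) : walk ω n = walk ω' n := by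
  induction n with
  | zero => rfl
  | succ n ih => rw [walk, walk, ih fun i hi => h i (by omega), h n (by omega)]

theorem exists_walk_eq_of_mem_closure {s : Set G} {g : G} (hg : g ∈ Submonoid.closure s) :
    ∃ (k : ℕ) (a : ℕ → G), (∀ i < k, a i ∈ s) ∧ walk a k = g := by
  induction hg using Submonoid.closure_induction_right with
  | one => exact ⟨0, fun _ => 1, by simp, rfl⟩
  | mul_right x hx y hy ih =>
    obtain ⟨k, a, ha, rfl⟩ := ih
    refine ⟨k + 1, fun i => if i < k then a i else y, fun i hi => ?_, ?_⟩
    · by_cases h : i < k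
      · simpa [h] using ha i h
      · simpa [h] using hy
    · rw [walk, walk_congr (ω' := a) fun i hi => by simp [hi]]
      simp

end WalkLemmas

section StepLaw

variable {G : Type*} [MeasurableSpace G]

theorem measurePreserving_shift [Group G] (μ : Measure G) [IsProbabilityMeasure μ] (k : ℕ) :
    MeasurePreserving (fun (ω : ℕ → G) i => ω (i + k)) (stepLaw μ) (stepLaw μ) :=
  ⟨by fun_prop, Measure.map_infinitePi_infinitePi_of_inj (P := fun _ : ℕ => μ)
    (add_left_injective k)⟩

instance [Group G] (μ : Measure G) [IsProbabilityMeasure μ] :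
    IsProbabilityMeasure (stepLaw μ) := by
  unfold stepLaw; infer_instance

variable [Countable G] [DiscreteMeasurableSpace G] {β γ : Type*} [MeasurableSpace β]
  [MeasurableSpace γ]

/-- Such a function factors through finitely many coordinates in a countable discrete G, where every
map is measurable. -/
theorem measurable_of_dependsOn {F : (ℕ → G) → β} {S : Finset ℕ} (hF : DependsOn F (S : Set ℕ)) :
    Measurable F := by
  rcases isEmpty_or_nonempty β with hβ | hβ
  · have : IsEmpty (ℕ → G) := ⟨fun ω => hβ.elim (F ω)⟩
    exact measurable_of_empty F
  · obtain ⟨f, rfl⟩ := dependsOn_iff_exists_comp.1 hF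
    exact (Measurable.of_discrete (f := f)).comp
      (measurable_pi_lambda _ fun i => measurable_pi_apply _)

theorem indepFun_of_dependsOn [Group G] (μ : Measure G) [IsProbabilityMeasure μ]
    [Nonempty β] [Nonempty γ] {F : (ℕ → G) → β} {F' : (ℕ → G) → γ} {S T : Finset ℕ}
    (hST : Disjoint S T) (hF : DependsOn F (S : Set ℕ)) (hF' : DependsOn F' (T : Set ℕ)) :
    IndepFun F F' (stepLaw μ) := by
  obtain ⟨f, rfl⟩ := dependsOn_iff_exists_comp.1 hF
  obtain ⟨f', rfl⟩ := dependsOn_iff_exists_comp.1 hF'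
  have h := (iIndepFun_infinitePi (P := fun _ : ℕ => μ) (X := fun _ g => g)
    (fun _ => measurable_id)).indepFun_finset S T hST (fun i => measurable_pi_apply i)
  exact h.comp (φ := f) (ψ := f') Measurable.of_discrete Measurable.of_discrete

/-- The strong law of large numbers for a function of disjoint blocks of increments. -/
theorem strong_law_blocks [Group G] (μ : Measure G) [IsProbabilityMeasure μ] {k : ℕ}
    {F : (ℕ → G) → ℝ} (hF : DependsOn F (Finset.range k : Set ℕ))
    (hint : Integrable F (stepLaw μ)) :
    ∀ᵐ ω ∂(stepLaw μ), Tendsto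
      (fun n : ℕ => (∑ j ∈ Finset.range n, F fun i => ω (i + j * k)) / n) atTop
      (𝓝 (∫ ω, F ω ∂(stepLaw μ))) := by
  have hmp := fun j : ℕ => measurePreserving_shift μ (j * k)
  have hX : ∀ j : ℕ, DependsOn (fun ω : ℕ → G => F fun i => ω (i + j * k))
      (Finset.Ico (j * k) (j * k + k) : Set ℕ) := fun j ω ω' h => hF fun i hi => h _ <| by
    simp only [Finset.coe_range, Set.mem_Iio] at hi
    simp only [Finset.coe_Ico, Set.mem_Ico]
    omega
  have h0 : (fun ω : ℕ → G => F fun i => ω (i + 0 * k)) = F := by simp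
  have hFm := measurable_of_dependsOn hF
  have := strong_law_ae_real (μ := stepLaw μ) (fun (j : ℕ) (ω : ℕ → G) => F fun i => ω (i + j * k))
    (by rw [h0]; exact hint) (fun a b hab => indepFun_of_dependsOn μ ?_ (hX a) (hX b))
    (fun j => ?_)
  · simpa only [h0] using this
  · rw [Finset.disjoint_left]
    intro x hxa hxb
    simp only [Finset.mem_Ico] at hxa hxb
    rcases lt_or_gt_of_ne hab with h | h
    · nlinarith [Nat.mul_le_mul_right k (Nat.succ_le_of_lt h)]
    · nlinarith [Nat.mul_le_mul_right k (Nat.succ_le_of_lt h)]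
  · refine ⟨(hFm.comp (hmp j).measurable).aemeasurable, ?_, ?_⟩
    · rw [h0]; exact hFm.aemeasurable
    · rw [h0]
      change Measure.map (F ∘ fun (ω : ℕ → G) i => ω (i + j * k)) _ = _
      rw [← Measure.map_map hFm (hmp j).measurable, (hmp j).map_eq]

end StepLaw

/-! ### Almost sure unboundedness of the walk. -/

section Unbounded

variable {G X : Type*} [Group G] [Countable G] [MeasurableSpace G] [DiscreteMeasurableSpace G]
  [MetricSpace X] [MulAction G X] [IsIsometricSMul G X]

/-- Every finite pattern of increments of positive probability occurs almost surely. -/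
theorem ae_exists_pattern (μ : Measure G) [IsProbabilityMeasure μ] {k : ℕ} {a : ℕ → G}
    (ha : ∀ i < k, μ {a i} ≠ 0) :
    ∀ᵐ ω ∂(stepLaw μ), ∃ n, ∀ i < k, ω (i + n) = a i := by
  classical
  set B : Set (ℕ → G) := Set.pi (Finset.range k : Set ℕ) fun i => {a i} with hB
  have hBm : MeasurableSet B := MeasurableSet.pi (Finset.countable_toSet _) fun _ _ =>
    MeasurableSet.of_discrete
  have hmem : ∀ ω, ω ∈ B ↔ ∀ i < k, ω i = a i := fun ω => by simp [hB, Set.mem_pi]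
  have hP : stepLaw μ B ≠ 0 := by
    rw [stepLaw, hB, Measure.infinitePi_pi _ fun _ _ => MeasurableSet.of_discrete,
      Finset.prod_ne_zero_iff]
    exact fun i hi => ha i (Finset.mem_range.1 hi)
  have hdep : DependsOn (B.indicator fun _ => (1 : ℝ)) (Finset.range k : Set ℕ) := by
    intro ω ω' h
    have : ω ∈ B ↔ ω' ∈ B := by
      simp only [hmem]
      exact forall₂_congr fun i hi => by rw [h i (by simpa using hi)]
    by_cases hω : ω ∈ B
    · simp [hω, this.1 hω]
    · rw [Set.indicator_of_notMem hω, Set.indicator_of_notMem fun h => hω (this.2 h)]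
  have hint : Integrable (B.indicator fun _ => (1 : ℝ)) (stepLaw μ) :=
    (integrable_const 1).indicator hBm
  -- If the pattern never occurred, its frequency over disjoint blocks would be 0, whereas the
  -- strong law gives the positive probability of the pattern.
  filter_upwards [strong_law_blocks μ hdep hint] with ω hω
  by_contra! hno
  have hz : ∀ j : ℕ, B.indicator (fun _ => (1 : ℝ)) (fun i => ω (i + j * k)) = 0 := fun j => by
    refine Set.indicator_of_notMem (fun hj => ?_) _
    obtain ⟨i, hi, hne⟩ := hno (j * k)
    exact hne ((hmem _).1 hj i hi)
  simp only [hz, Finset.sum_const_zero, zero_div] at hω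
  have := tendsto_nhds_unique hω tendsto_const_nhds
  rw [integral_indicator_const _ hBm] at this
  simp [measureReal_def, ENNReal.toReal_eq_zero_iff, hP] at this

/-- If the semigroup generated by the support has an unbounded orbit, then almost every path is
unbounded. -/
theorem ae_walk_unbounded (μ : Measure G) [IsProbabilityMeasure μ] {o : X}
    (hunb : ∀ C : ℝ, ∃ g ∈ Submonoid.closure {g | μ {g} ≠ 0}, C ≤ dist o (g • o)) :
    ∀ᵐ ω ∂(stepLaw μ), ∀ C : ℝ, ∃ n, C ≤ dist o (walk ω n • o) := by
  have key : ∀ C : ℕ, ∀ᵐ ω ∂(stepLaw μ), ∃ n, (C : ℝ) ≤ dist o (walk ω n • o) := by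
    intro C
    -- A displacement of 2C between two positions of the walk forces one of them to be at distance
    -- at least C from o.
    obtain ⟨g, hg, hd⟩ := hunb (2 * C)
    obtain ⟨k, a, ha, rfl⟩ := exists_walk_eq_of_mem_closure hg
    filter_upwards [ae_exists_pattern μ ha] with ω ⟨n, hn⟩
    by_contra! hlt
    have h1 := hlt n
    have h2 := hlt (n + k)
    have h3 := dist_triangle_left (walk ω n • o) (walk ω (n + k) • o) o
    rw [walk_add, walk_congr hn] at h2 h3
    rw [mul_smul, dist_smul] at h3
    rw [mul_smul] at h2
    linarith
  filter_upwards [ae_all_iff.2 key] with ω hω C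
  obtain ⟨k, hk⟩ := exists_nat_ge C
  obtain ⟨n, hn⟩ := hω k
  exact ⟨n, hk.trans hn⟩

end Unbounded

/-! ### Martingale convergence for bounded harmonic functions. -/

section Harmonic

variable {G : Type*} [Group G] [Countable G] [MeasurableSpace G] [DiscreteMeasurableSpace G]

/-- The filtration generated by the increments. -/
def stepFiltration (G : Type*) [MeasurableSpace G] :
    Filtration ℕ (inferInstance : MeasurableSpace (ℕ → G)) where
  seq n := MeasurableSpace.comap (Finset.restrict (π := fun _ => G) (Finset.range n)) inferInstance
  mono' n m hnm := by
    have : Finset.restrict (π := fun _ => G) (Finset.range n) =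
        Finset.restrict₂ (π := fun _ => G) (Finset.range_mono hnm) ∘
          Finset.restrict (Finset.range m) := rfl
    change MeasurableSpace.comap _ _ ≤ MeasurableSpace.comap _ _
    rw [this, ← MeasurableSpace.comap_comp]
    exact MeasurableSpace.comap_mono (Finset.measurable_restrict₂ _).comap_le
  le' n := (Finset.measurable_restrict _).comap_le

/-- A bounded harmonic function converges along almost every path of the walk. -/
theorem ae_tendsto_harmonic (μ : Measure G) [IsProbabilityMeasure μ] {φ : G → ℝ}
    (h0 : ∀ g, 0 ≤ φ g) (h1 : ∀ g, φ g ≤ 1) (hφ : ∀ h, φ h = ∫ g, φ (h * g) ∂μ) :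
    ∀ᵐ ω ∂(stepLaw μ), ∃ c, Tendsto (fun n => φ (walk ω n)) atTop (𝓝 c) := by
  have hnorm : ∀ g, ‖φ g‖ ≤ 1 := fun g => by rw [Real.norm_of_nonneg (h0 g)]; exact h1 g
  have hdep : ∀ n, DependsOn (fun ω : ℕ → G => φ (walk ω n)) (Finset.range n : Set ℕ) :=
    fun n ω ω' h => congrArg φ (walk_congr fun i hi => h i (by simpa using hi))
  have hint : ∀ n, Integrable (fun ω : ℕ → G => φ (walk ω n)) (stepLaw μ) := fun n =>
    Integrable.of_bound (measurable_of_dependsOn (hdep n)).aestronglyMeasurable 1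
      (Eventually.of_forall fun ω => hnorm _)
  have hmart : Martingale (fun n (ω : ℕ → G) => φ (walk ω n)) (stepFiltration G) (stepLaw μ) := by
    refine martingale_of_setIntegral_eq_succ (fun n => ?_) hint fun n s hs => ?_
    · obtain ⟨f, hf⟩ := dependsOn_iff_exists_comp.1 (hdep n)
      change StronglyMeasurable[MeasurableSpace.comap _ _] _
      simp only [hf]
      exact ((Measurable.of_discrete (f := f)).comp (comap_measurable _)).stronglyMeasurable
    · obtain ⟨E, -, rfl⟩ := hs
      set r : (ℕ → G) → (Finset.range n → G) := Finset.restrict (Finset.range n) with hr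
      have hrm : Measurable r := Finset.measurable_restrict _
      have hsm : MeasurableSet (r ⁻¹' E) := hrm MeasurableSet.of_discrete
      obtain ⟨W, hW⟩ : ∃ W : (Finset.range n → G) → G,
          (fun ω : ℕ → G => walk ω n) = W ∘ r :=
        dependsOn_iff_exists_comp.1 fun ω ω' h => walk_congr fun i hi => h i (by simpa using hi)
      have hW' : ∀ ω, walk ω n = W (r ω) := fun ω => congrFun hW ω
      set ψ : (Finset.range n → G) × G → ℝ := fun q => E.indicator (fun v => φ (W v * q.2)) q.1
        with hψ
      -- The next increment is independent of the past, so the joint law is a product and Fubini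
      -- reduces the martingale identity to harmonicity.
      have hind : IndepFun r (fun ω : ℕ → G => ω n) (stepLaw μ) := by
        have : Nonempty G := ⟨1⟩
        refine indepFun_of_dependsOn μ (S := Finset.range n) (T := {n}) (by simp) ?_ ?_
        · intro ω ω' h; ext i; exact h i i.2
        · intro ω ω' h; exact h n (by simp)
      have hmapn : (stepLaw μ).map (fun ω : ℕ → G => ω n) = μ :=
        Measure.infinitePi_map_eval _ n
      have hmap := hind.map_prod_eq_prod_map_map hrm.aemeasurable
        (measurable_pi_apply n).aemeasurable
      rw [hmapn] at hmap
      have hpr : IsProbabilityMeasure ((stepLaw μ).map r) :=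
        Measure.isProbabilityMeasure_map hrm.aemeasurable
      have hψm : Measurable ψ := Measurable.of_discrete
      have hψi : Integrable ψ (((stepLaw μ).map r).prod μ) :=
        Integrable.of_bound hψm.aestronglyMeasurable 1 (Eventually.of_forall fun q => by
          by_cases hq : q.1 ∈ E
          · simpa [hψ, hq] using hnorm (W q.1 * q.2)
          · simp [hψ, hq])
      have hinner : ∀ v, ∫ g, ψ (v, g) ∂μ = E.indicator (fun v => φ (W v)) v := fun v => by
        by_cases hv : v ∈ E
        · simp only [hψ, Set.indicator_of_mem hv]; exact (hφ _).symm
        · simp [hψ, hv]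
      calc ∫ ω in r ⁻¹' E, φ (walk ω n) ∂(stepLaw μ)
          = ∫ ω, E.indicator (fun v => φ (W v)) (r ω) ∂(stepLaw μ) := by
            rw [← integral_indicator hsm]
            refine integral_congr_ae (Eventually.of_forall fun ω => ?_)
            by_cases hω : r ω ∈ E <;> simp [Set.indicator, hω, hW']
        _ = ∫ v, E.indicator (fun v => φ (W v)) v ∂((stepLaw μ).map r) := by
            rw [integral_map hrm.aemeasurable
              (Measurable.of_discrete (f := E.indicator fun v => φ (W v))).aestronglyMeasurable]
        _ = ∫ q, ψ q ∂(((stepLaw μ).map r).prod μ) := by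
            rw [integral_prod _ hψi]; simp only [hinner]
        _ = ∫ ω, ψ (r ω, ω n) ∂(stepLaw μ) := by
            rw [← hmap, integral_map (hrm.prodMk (measurable_pi_apply n)).aemeasurable
              hψm.aestronglyMeasurable]
        _ = ∫ ω in r ⁻¹' E, φ (walk ω (n + 1)) ∂(stepLaw μ) := by
            rw [← integral_indicator hsm]
            refine integral_congr_ae (Eventually.of_forall fun ω => ?_)
            by_cases hω : r ω ∈ E <;> simp [Set.indicator, hψ, hω, hW', walk]
  refine hmart.submartingale.exists_ae_tendsto_of_bdd (R := 1) fun n => ?_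
  refine (eLpNorm_le_of_ae_bound (C := 1) (Eventually.of_forall fun ω => hnorm _)).trans ?_
  simp

end Harmonic

/-! ### Convergence of the walk to the boundary. -/

section BoundaryConvergence

variable {G X : Type*} [Group G] [Countable G] [MeasurableSpace G] [DiscreteMeasurableSpace G]
  [MetricSpace X] [MulAction G X] [IsIsometricSMul G X]

/-- Almost every path of a non-elementary random walk with unbounded orbit is a Gromov sequence. -/
theorem ae_gromovAsymptotic_walk [ProperSpace X] (hgeod : IsGeodesicSpace X) {κ : ℝ}
    (hκ : FourPoint X κ) (μ : Measure G) [IsProbabilityMeasure μ]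
    (hne : ¬ IsElementary X (supportSubgroup μ)) {o : X}
    (hunb : ¬ Bornology.IsBounded (MulAction.orbit (supportSubgroup μ) o)) :
    ∀ᵐ ω ∂(stepLaw μ), GromovAsymptotic (fun n => walk ω n • o) (fun n => walk ω n • o) := by
  have : Nonempty X := ⟨o⟩
  have htsum : ∑' g, μ {g} = 1 := by
    have := lintegral_countable' (μ := μ) fun _ => 1
    simpa using this.symm
  have hw : HasSum (fun g => μ.real {g}) 1 := by
    have := ENNReal.hasSum_toReal (f := fun g => μ {g}) (by simp [htsum])
    rwa [← ENNReal.tsum_toReal_eq (by simp), htsum] at this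
  have hw0 : ∀ g, 0 ≤ μ.real {g} := fun g => measureReal_nonneg
  obtain ⟨m, hm, hstat⟩ := exists_stationary_content (X := X) hw0 hw
  have hsupp : {g | μ.real {g} ≠ 0} = {g | μ {g} ≠ 0} := by
    ext g; simp [measureReal_def, ENNReal.toReal_eq_zero_iff]
  have hshadow : ∀ ε > 0, ∃ T : ℝ, ∀ p : X, m {z | T ≤ gromovProduct o z p} ≤ ε := fun ε hε =>
    exists_shadow_le hgeod hκ hm hw0 hw hstat (by rw [hsupp]; exact hne) o hε
  -- Stationarity of m is exactly harmonicity of these functions of h. There are countably many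
  -- pairs (g, R), so almost surely all of them converge.
  have hlim : ∀ (g : G) (R : ℕ), ∀ᵐ ω ∂(stepLaw μ), ∃ c, Tendsto
      (fun n => m {z | (R : ℝ) ≤ gromovProduct o (walk ω n • z) (g • o)}) atTop (𝓝 c) := by
    intro g R
    refine ae_tendsto_harmonic μ
      (φ := fun h => m {z | (R : ℝ) ≤ gromovProduct o (h • z) (g • o)})
      (fun h => hm.nonneg _) (fun h => hm.le_one _) fun h => ?_
    rw [integral_countable, hstat]
    · simp only [mul_smul, smul_eq_mul]; rfl
    · exact Integrable.of_bound Measurable.of_discrete.aestronglyMeasurable 1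
        (Eventually.of_forall fun x => by
          rw [Real.norm_of_nonneg (hm.nonneg _)]; exact hm.le_one _)
  filter_upwards [ae_all_iff.2 fun g => ae_all_iff.2 (hlim g),
    ae_walk_unbounded μ (exists_mem_submonoid_closure_dist_ge hunb)] with ω h1 h2
  exact gromovAsymptotic_of_tendsto_content hgeod hκ hm o hshadow (walk ω) h1 h2

end BoundaryConvergence

/-! ### A subadditive ergodic inequality. -/

section Subadditive

open scoped ENNReal

variable {G : Type*} {α : ℕ → (ℕ → G) → ℝ≥0∞} {g : (ℕ → G) → ℝ≥0∞} {K : ℕ}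

/-- Covering the path greedily by good blocks of length at most `K`. -/
theorem subadditive_le_sum_add_tail
    (h0 : ∀ ω, α 0 ω = 0)
    (hsub : ∀ n m ω, α (n + m) ω ≤ α n ω + α m fun i => ω (i + n))
    (hgood : ∀ ω, ∃ k, 1 ≤ k ∧ k ≤ K ∧ α k ω ≤ ∑ i ∈ Finset.range k, g fun j => ω (j + i))
    (n : ℕ) (ω : ℕ → G) :
    α n ω ≤ ∑ i ∈ Finset.range n, (g fun j => ω (j + i)) +
      ∑ i ∈ Finset.range n, if n ≤ i + K then α 1 fun j => ω (j + i) else 0 := by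
  have htriv : ∀ n ω, α n ω ≤ ∑ i ∈ Finset.range n, α 1 fun j => ω (j + i) := by
    intro n
    induction n with
    | zero => intro ω; simp [h0]
    | succ n ih => intro ω; rw [Finset.sum_range_succ]; exact (hsub n 1 ω).trans (by gcongr; exact ih ω)
  induction n using Nat.strong_induction_on generalizing ω with
  | _ n ih =>
    obtain ⟨k, hk1, hkK, hk⟩ := hgood ω
    rcases le_or_gt k n with hkn | hkn
    · obtain ⟨m, rfl⟩ := Nat.exists_eq_add_of_le hkn
      have h1 := ih m (by omega) fun i => ω (i + k)
      rw [Finset.sum_range_add, Finset.sum_range_add]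
      have e : ∀ i, (fun j => ω (j + i + k)) = fun j => ω (j + (k + i)) := fun i => by
        ext j; congr 1; ring
      simp only [e] at h1
      have e2 : ∀ i, (k + m ≤ k + i + K) ↔ m ≤ i + K := fun i => by omega
      simp only [e2]
      calc α (k + m) ω ≤ α k ω + α m (fun i => ω (i + k)) := hsub k m ω
        _ ≤ _ := add_le_add hk h1
        _ ≤ _ := by
          rw [← add_assoc]
          gcongr
          exact le_add_self
    -- The good block overruns the end. Then n < k ≤ K, so every remaining index is in the tail and
    -- is paid for by single steps.
    · refine (htriv n ω).trans (le_add_left (Finset.sum_le_sum fun i hi => ?_))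
      rw [if_pos (by omega)]

variable [Group G] [MeasurableSpace G]

theorem lintegral_shift (μ : Measure G) [IsProbabilityMeasure μ] {f : (ℕ → G) → ℝ≥0∞}
    (hf : Measurable f) (k : ℕ) :
    ∫⁻ ω, f (fun i => ω (i + k)) ∂(stepLaw μ) = ∫⁻ ω, f ω ∂(stepLaw μ) :=
  (measurePreserving_shift μ k).lintegral_comp hf

/-- Integrate the covering bound using shift invariance: the tail costs at most K + 1 integrals of
`α 1`, a constant that vanishes after division by n. -/
theorem le_lintegral_of_good_blocks (μ : Measure G) [IsProbabilityMeasure μ]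
    (hα : Measurable (α 1)) (hα1 : ∫⁻ ω, α 1 ω ∂(stepLaw μ) ≠ ∞) (hg : Measurable g)
    (h0 : ∀ ω, α 0 ω = 0)
    (hsub : ∀ n m ω, α (n + m) ω ≤ α n ω + α m fun i => ω (i + n))
    (hgood : ∀ ω, ∃ k, 1 ≤ k ∧ k ≤ K ∧ α k ω ≤ ∑ i ∈ Finset.range k, g fun j => ω (j + i))
    {A : ℝ≥0∞} (hA : ∀ n : ℕ, n * A ≤ ∫⁻ ω, α n ω ∂(stepLaw μ)) :
    A ≤ ∫⁻ ω, g ω ∂(stepLaw μ) := by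
  set I := ∫⁻ ω, g ω ∂(stepLaw μ)
  set J := ∫⁻ ω, α 1 ω ∂(stepLaw μ)
  have hsh : ∀ k : ℕ, Measurable fun (ω : ℕ → G) i => ω (i + k) := fun k => by fun_prop
  have hn : ∀ n : ℕ, (n : ℝ≥0∞) * A ≤ n * I + (K + 1 : ℕ) * J := by
    intro n
    refine (hA n).trans ((lintegral_mono (subadditive_le_sum_add_tail h0 hsub hgood n)).trans ?_)
    have hgs : ∀ i, Measurable fun ω : ℕ → G => g fun j => ω (j + i) := fun i => hg.comp (hsh i)
    rw [lintegral_add_left (Finset.measurable_fun_sum _ fun i _ => hgs i),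
      lintegral_finsetSum _ fun i _ => hgs i]
    have hif : ∀ i, Measurable fun ω : ℕ → G => if n ≤ i + K then α 1 fun j => ω (j + i) else 0 :=
      fun i => by split_ifs; exacts [hα.comp (hsh i), measurable_const]
    rw [lintegral_finsetSum _ fun i _ => hif i]
    have e1 : ∀ i, ∫⁻ ω, g (fun j => ω (j + i)) ∂(stepLaw μ) = I := fun i => lintegral_shift μ hg i
    have e2 : ∀ i, ∫⁻ ω : ℕ → G, (if n ≤ i + K then α 1 fun j => ω (j + i) else 0) ∂(stepLaw μ) =
        if n ≤ i + K then J else 0 := fun i => by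
      split_ifs
      · exact lintegral_shift μ hα i
      · simp
    simp only [e1, e2, Finset.sum_const, Finset.card_range, nsmul_eq_mul]
    gcongr
    rw [← Finset.sum_filter, Finset.sum_const, nsmul_eq_mul]
    gcongr
    calc _ ≤ (Finset.Ico (n - K) (n - K + (K + 1))).card := Finset.card_le_card fun i hi => by
          simp only [Finset.mem_filter, Finset.mem_range, Finset.mem_Ico] at hi ⊢; omega
      _ = K + 1 := by simp
  have hC : ((K + 1 : ℕ) : ℝ≥0∞) * J ≠ ∞ := ENNReal.mul_ne_top (by simp) hα1
  have hlim : Tendsto (fun n : ℕ => I + ((K + 1 : ℕ) : ℝ≥0∞) * J * (n : ℝ≥0∞)⁻¹) atTop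
      (𝓝 (I + ((K + 1 : ℕ) : ℝ≥0∞) * J * 0)) :=
    tendsto_const_nhds.add (ENNReal.Tendsto.const_mul ENNReal.tendsto_inv_nat_nhds_zero (Or.inr hC))
  rw [mul_zero, add_zero] at hlim
  refine ge_of_tendsto hlim ?_
  filter_upwards [eventually_gt_atTop 0] with n hn0
  have hne : (n : ℝ≥0∞) ≠ 0 := by exact_mod_cast hn0.ne'
  calc A = (n : ℝ≥0∞)⁻¹ * (n * A) := by
        rw [← mul_assoc, ENNReal.inv_mul_cancel hne (by simp), one_mul]
    _ ≤ (n : ℝ≥0∞)⁻¹ * (n * I + (K + 1 : ℕ) * J) := by gcongr; exact hn n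
    _ = _ := by rw [mul_add, ← mul_assoc, ENNReal.inv_mul_cancel hne (by simp), one_mul,
                  mul_comm (n : ℝ≥0∞)⁻¹]

/-- The lower half of the subadditive ergodic theorem. -/
theorem le_lintegral_of_liminf (μ : Measure G) [IsProbabilityMeasure μ]
    (hα : ∀ n, Measurable (α n)) (hα1 : ∫⁻ ω, α 1 ω ∂(stepLaw μ) ≠ ∞)
    (h0 : ∀ ω, α 0 ω = 0)
    (hsub : ∀ n m ω, α (n + m) ω ≤ α n ω + α m fun i => ω (i + n))
    {f : (ℕ → G) → ℝ≥0∞} (hf : Measurable f) (hfT : ∀ ω k, f ω ≤ f fun i => ω (i + k))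
    (hfα : ∀ᵐ ω ∂(stepLaw μ), ∀ ε : ℝ≥0∞, 0 < ε → ∃ k : ℕ, 1 ≤ k ∧ α k ω ≤ k * (f ω + ε))
    {A : ℝ≥0∞} (hA : ∀ n : ℕ, n * A ≤ ∫⁻ ω, α n ω ∂(stepLaw μ)) :
    A ≤ ∫⁻ ω, f ω ∂(stepLaw μ) := by
  refine ENNReal.le_of_forall_pos_le_add fun ε hε _ => ?_
  -- On `bad K` no block of length at most K achieves the rate f + ε. There a block of length one is
  -- used and `α 1` is added to the cost; elsewhere, monotonicity of f under the shift bounds the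
  -- block by the sum of the costs along it.
  set bad : ℕ → Set (ℕ → G) := fun K => {ω | ∀ k, 1 ≤ k → k ≤ K → k * (f ω + ε) < α k ω} with hbad
  have hbadm : ∀ K, MeasurableSet (bad K) := fun K => by
    simp only [hbad, Set.ofPred_forall]
    exact MeasurableSet.iInter fun k => MeasurableSet.iInter fun _ => MeasurableSet.iInter fun _ =>
      measurableSet_lt ((hf.add_const _).const_mul _) (hα k)
  have hgm : ∀ K, Measurable fun ω => f ω + ε + (bad K).indicator (α 1) ω := fun K =>
    (hf.add_const _).add ((hα 1).indicator (hbadm K))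
  have hle : ∀ K : ℕ, A ≤ ∫⁻ ω, f ω ∂(stepLaw μ) + ε +
      ∫⁻ ω, (bad (K + 1)).indicator (α 1) ω ∂(stepLaw μ) := by
    intro K
    refine (le_lintegral_of_good_blocks μ (K := K + 1) (hα 1) hα1 (hgm (K + 1)) h0 hsub
      (fun ω => ?_) hA).trans ?_
    · by_cases hω : ω ∈ bad (K + 1)
      · refine ⟨1, le_rfl, by omega, ?_⟩
        simp [hω]
      · simp only [hbad, Set.mem_ofPred_eq, not_forall, not_lt] at hω
        obtain ⟨k, hk1, hkK, hk⟩ := hω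
        refine ⟨k, hk1, hkK, hk.trans ?_⟩
        calc (k : ℝ≥0∞) * (f ω + ε) = ∑ i ∈ Finset.range k, (f ω + ε) := by
              rw [Finset.sum_const, Finset.card_range, nsmul_eq_mul]
          _ ≤ _ := Finset.sum_le_sum fun i _ =>
            le_add_right (add_le_add_left (hfT ω i) _)
    · rw [lintegral_add_left (hf.add_const _), lintegral_add_left hf]
      simp
  -- Almost every ω leaves the bad sets as K grows, so the extra cost tends to 0, dominated by the
  -- integrable `α 1`.
  have hlim : Tendsto (fun K : ℕ => ∫⁻ ω, (bad (K + 1)).indicator (α 1) ω ∂(stepLaw μ)) atTop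
      (𝓝 (∫⁻ _, 0 ∂(stepLaw μ))) := by
    refine tendsto_lintegral_of_dominated_convergence (α 1)
      (fun K => (hα 1).indicator (hbadm _))
      (fun K => Eventually.of_forall fun ω => Set.indicator_le_self _ _ _) hα1 ?_
    filter_upwards [hfα] with ω hω
    obtain ⟨k, hk1, hk⟩ := hω ε (by exact_mod_cast hε)
    refine tendsto_const_nhds.congr' ?_
    filter_upwards [eventually_ge_atTop k] with K hK
    refine (Set.indicator_of_notMem (fun hmem => ?_) _).symm
    exact absurd (hmem k hk1 (by omega)) hk.not_gt
  rw [lintegral_zero] at hlim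
  simpa using ge_of_tendsto' (tendsto_const_nhds.add hlim) hle

end Subadditive

/-! ### Displacement of the walk and its rate. -/

section WalkStep

variable {G X : Type*} [Group G] [MetricSpace X] [MulAction G X]

theorem dist_walk_one (o : X) (ω : ℕ → G) : dist o (walk ω 1 • o) = dist o (ω 0 • o) := by
  simp [walk]

theorem dependsOn_dist_walk (o : X) (n : ℕ) :
    DependsOn (fun ω : ℕ → G => dist o (walk ω n • o)) (Finset.range n : Set ℕ) :=
  fun ω ω' h => by
    change dist o (walk ω n • o) = dist o (walk ω' n • o)
    rw [walk_congr fun i hi => h i (by simpa using hi)]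

theorem integrable_dist_step [MeasurableSpace G] (μ : Measure G) [IsProbabilityMeasure μ] {o : X}
    (ho : Integrable (fun g : G => dist o (g • o)) μ) (i : ℕ) :
    Integrable (fun ω : ℕ → G => dist o (ω i • o)) (stepLaw μ) :=
  (measurePreserving_eval_infinitePi (fun _ : ℕ => μ) i).integrable_comp_of_integrable ho

theorem measurable_dist_walk [Countable G] [MeasurableSpace G]
    [DiscreteMeasurableSpace G] (o : X) (n : ℕ) :
    Measurable fun ω : ℕ → G => dist o (walk ω n • o) :=
  measurable_of_dependsOn (dependsOn_dist_walk o n)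

theorem integral_dist_walk_shift [Countable G] [MeasurableSpace G]
    [DiscreteMeasurableSpace G] (μ : Measure G) [IsProbabilityMeasure μ] (o : X) (n k : ℕ) :
    ∫ ω : ℕ → G, dist o (walk (fun i => ω (i + k)) n • o) ∂(stepLaw μ) =
      ∫ ω : ℕ → G, dist o (walk ω n • o) ∂(stepLaw μ) := by
  have h := measurePreserving_shift μ k
  rw [← integral_map (φ := fun (ω : ℕ → G) i => ω (i + k))
    (f := fun ω : ℕ → G => dist o (walk ω n • o)) h.measurable.aemeasurable
    (measurable_dist_walk o n).aestronglyMeasurable, h.map_eq]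

end WalkStep

section WalkDist

variable {G X : Type*} [Group G] [MetricSpace X] [MulAction G X] [IsIsometricSMul G X]

theorem dist_walk_add_le (o : X) (n m : ℕ) (ω : ℕ → G) :
    dist o (walk ω (n + m) • o) ≤
      dist o (walk ω n • o) + dist o (walk (fun i => ω (i + n)) m • o) := by
  rw [walk_add, mul_smul]
  refine (dist_triangle _ (walk ω n • o) _).trans_eq ?_
  rw [dist_smul]

theorem dist_walk_mul_le (o : X) (k q : ℕ) (ω : ℕ → G) :
    dist o (walk ω (q * k) • o) ≤
      ∑ j ∈ Finset.range q, dist o (walk (fun i => ω (i + j * k)) k • o) := by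
  induction q with
  | zero => simp [walk]
  | succ q ih =>
    rw [Nat.succ_mul, Finset.sum_range_succ]
    exact (dist_walk_add_le o _ _ ω).trans (by gcongr)

theorem dist_walk_le_add_sum (o : X) (n m : ℕ) (ω : ℕ → G) (hnm : m ≤ n) :
    dist o (walk ω n • o) ≤ dist o (walk ω m • o) +
      (∑ i ∈ Finset.range n, dist o (ω i • o) - ∑ i ∈ Finset.range m, dist o (ω i • o)) := by
  induction n, hnm using Nat.le_induction with
  | base => simp
  | succ n _ ih =>
    have := dist_walk_add_le o n 1 ω
    rw [dist_walk_one, zero_add] at this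
    rw [Finset.sum_range_succ]
    linarith

end WalkDist

section Drift

open scoped ENNReal

variable {G X : Type*} [Group G] [Countable G] [MeasurableSpace G] [DiscreteMeasurableSpace G]
  [MetricSpace X] [MulAction G X] [IsIsometricSMul G X]

theorem integrable_dist_walk (μ : Measure G) [IsProbabilityMeasure μ] {o : X}
    (ho : Integrable (fun g : G => dist o (g • o)) μ) (n : ℕ) :
    Integrable (fun ω : ℕ → G => dist o (walk ω n • o)) (stepLaw μ) := by
  refine (integrable_finsetSum (Finset.range n) fun i _ => integrable_dist_step μ ho i).mono'
    (measurable_dist_walk o n).aestronglyMeasurable (Eventually.of_forall fun ω => ?_)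
  rw [Real.norm_of_nonneg dist_nonneg]
  simpa [walk] using dist_walk_le_add_sum o n 0 ω (Nat.zero_le n)

theorem subadditive_integral_dist_walk (μ : Measure G) [IsProbabilityMeasure μ] {o : X}
    (ho : Integrable (fun g : G => dist o (g • o)) μ) :
    Subadditive fun n => ∫ ω : ℕ → G, dist o (walk ω n • o) ∂(stepLaw μ) := by
  intro n m
  beta_reduce
  have hshift : Integrable (fun ω : ℕ → G => dist o (walk (fun i => ω (i + n)) m • o))
      (stepLaw μ) :=
    (measurePreserving_shift μ n).integrable_comp_of_integrable (integrable_dist_walk μ ho m)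
  rw [← integral_dist_walk_shift μ o m n, ← integral_add (integrable_dist_walk μ ho n) hshift]
  exact integral_mono (integrable_dist_walk μ ho _) ((integrable_dist_walk μ ho n).add hshift)
    fun ω => dist_walk_add_le o n m ω

theorem ae_tendsto_sum_steps (μ : Measure G) [IsProbabilityMeasure μ] {o : X}
    (ho : Integrable (fun g : G => dist o (g • o)) μ) :
    ∀ᵐ ω ∂(stepLaw μ), Tendsto
      (fun n : ℕ => (∑ i ∈ Finset.range n, dist o (ω i • o)) / n) atTop
      (𝓝 (∫ ω : ℕ → G, dist o (walk ω 1 • o) ∂(stepLaw μ))) := by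
  filter_upwards [strong_law_blocks μ (dependsOn_dist_walk (G := G) o 1)
    (integrable_dist_walk μ ho 1)] with ω hω
  simpa [dist_walk_one] using hω

theorem tendsto_natDiv_div {k : ℕ} (hk : k ≠ 0) :
    Tendsto (fun n : ℕ => ((n / k : ℕ) : ℝ) / n) atTop (𝓝 (1 / k)) := by
  have hk' : (0 : ℝ) < k := by exact_mod_cast Nat.pos_of_ne_zero hk
  have hlow : Tendsto (fun n : ℕ => (1 : ℝ) / k - 1 / n) atTop (𝓝 (1 / k - 0)) :=
    tendsto_const_nhds.sub tendsto_one_div_atTop_nhds_zero_nat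
  rw [sub_zero] at hlow
  refine tendsto_of_tendsto_of_tendsto_of_le_of_le' hlow tendsto_const_nhds ?_ ?_
  · filter_upwards [eventually_gt_atTop 0] with n hn
    have hn' : (0 : ℝ) < n := by exact_mod_cast hn
    have h1 : (n : ℝ) ≤ k * ((n / k : ℕ) : ℝ) + k := by
      have := (Nat.lt_mul_div_succ n (Nat.pos_of_ne_zero hk)).le
      exact_mod_cast this
    rw [div_sub_div _ _ hk'.ne' hn'.ne', div_le_div_iff₀ (by positivity) hn']
    nlinarith
  · filter_upwards [eventually_gt_atTop 0] with n hn
    have hn' : (0 : ℝ) < n := by exact_mod_cast hn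
    rw [div_le_div_iff₀ hn' hk']
    have := Nat.div_mul_le_self n k
    rw [one_mul]
    exact_mod_cast this

/-- The upper half of the law of large numbers for the displacement. -/
theorem ae_eventually_dist_walk_lt (μ : Measure G) [IsProbabilityMeasure μ] {o : X}
    (ho : Integrable (fun g : G => dist o (g • o)) μ) {k : ℕ} (hk : k ≠ 0) {c : ℝ}
    (hc : (∫ ω : ℕ → G, dist o (walk ω k • o) ∂(stepLaw μ)) / k < c) :
    ∀ᵐ ω ∂(stepLaw μ), ∀ᶠ n : ℕ in atTop, dist o (walk ω n • o) / n < c := by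
  filter_upwards [strong_law_blocks μ (dependsOn_dist_walk (G := G) o k)
    (integrable_dist_walk μ ho k), ae_tendsto_sum_steps μ ho] with ω h1 h2
  set L := ∫ ω : ℕ → G, dist o (walk ω k • o) ∂(stepLaw μ)
  set M := ∫ ω : ℕ → G, dist o (walk ω 1 • o) ∂(stepLaw μ)
  have hkpos : 0 < k := Nat.pos_of_ne_zero hk
  have hdiv : Tendsto (fun n : ℕ => n / k) atTop atTop := Nat.tendsto_div_const_atTop hk
  have hmul : Tendsto (fun n : ℕ => n / k * k) atTop atTop :=
    hdiv.atTop_mul_const' hkpos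
  -- Full blocks contribute L/k. The steps after the last full block contribute a difference of two
  -- quantities with the same limit M, hence nothing.
  have t1 := (h1.comp hdiv).mul (tendsto_natDiv_div hk)
  have t2 := (h2.comp hmul).mul ((tendsto_natDiv_div hk).mul_const (k : ℝ))
  have t3 := t1.add (h2.sub t2)
  have hk' : (k : ℝ) ≠ 0 := by exact_mod_cast hk
  rw [one_div_mul_cancel hk', mul_one, sub_self, add_zero, mul_one_div] at t3
  filter_upwards [t3.eventually_lt_const hc, eventually_ge_atTop k] with n hn hnk
  refine lt_of_le_of_lt ?_ hn
  have hn0 : (0 : ℝ) < n := by exact_mod_cast hkpos.trans_le hnk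
  have hq0 : (0 : ℝ) < ((n / k : ℕ) : ℝ) := by exact_mod_cast Nat.div_pos hnk hkpos
  have hle := (dist_walk_le_add_sum o n (n / k * k) ω (Nat.div_mul_le_self n k)).trans
    (add_le_add_left (dist_walk_mul_le o k (n / k) ω) _)
  rw [div_le_iff₀ hn0]
  refine hle.trans_eq ?_
  simp only [Function.comp, Nat.cast_mul]
  field_simp

/-- The displacement of a random walk with finite first moment has a deterministic rate. -/
theorem exists_drift (μ : Measure G) [IsProbabilityMeasure μ] {o : X}
    (ho : Integrable (fun g : G => dist o (g • o)) μ) :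
    ∃ A : ℝ≥0, ∀ᵐ ω ∂(stepLaw μ),
      Tendsto (fun n : ℕ => dist o (walk ω n • o) / n) atTop (𝓝 A) := by
  have hsub := subadditive_integral_dist_walk μ ho
  set E : ℕ → ℝ := fun n => ∫ ω : ℕ → G, dist o (walk ω n • o) ∂(stepLaw μ) with hE
  have hE0 : ∀ n, 0 ≤ E n := fun n => integral_nonneg fun ω => dist_nonneg
  have hbdd : BddBelow (Set.range fun n => E n / n) :=
    ⟨0, by rintro _ ⟨n, rfl⟩; exact div_nonneg (hE0 n) n.cast_nonneg⟩
  have hlim := hsub.tendsto_lim hbdd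
  have hA0 : 0 ≤ hsub.lim := ge_of_tendsto' hlim fun n => div_nonneg (hE0 n) n.cast_nonneg
  obtain ⟨A, hA⟩ : ∃ A : ℝ≥0, (A : ℝ) = hsub.lim := ⟨⟨_, hA0⟩, rfl⟩
  rw [← hA] at hlim
  refine ⟨A, ?_⟩
  have hup : ∀ᵐ ω ∂(stepLaw μ), ∀ j : ℕ, ∀ᶠ n : ℕ in atTop,
      dist o (walk ω n • o) / n < A + 1 / ((j : ℝ) + 1) := by
    refine ae_all_iff.2 fun j => ?_
    have hj : (A : ℝ) < A + 1 / ((j : ℝ) + 1) := by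
      have : (0 : ℝ) < 1 / ((j : ℝ) + 1) := by positivity
      linarith
    obtain ⟨k, hk, hk0⟩ := ((hlim.eventually_lt_const hj).and (eventually_ne_atTop 0)).exists
    exact ae_eventually_dist_walk_lt μ ho hk0 hk
  have hjlim : Tendsto (fun j : ℕ => (A : ℝ) + 1 / ((j : ℝ) + 1)) atTop (𝓝 A) := by
    simpa using (tendsto_const_nhds (x := (A : ℝ))).add
      (tendsto_one_div_add_atTop_nhds_zero_nat (𝕜 := ℝ))
  -- The upper bound gives f ≤ A almost everywhere, and the subadditive inequality gives A ≤ ∫ f; so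
  -- f = A almost everywhere, with no appeal to ergodicity.
  set f : (ℕ → G) → ℝ≥0∞ := fun ω =>
    liminf (fun n : ℕ => ENNReal.ofReal (dist o (walk ω n • o) / n)) atTop with hf
  have hfm : Measurable f := Measurable.liminf fun n =>
    ((measurable_dist_walk o n).div_const _).ennreal_ofReal
  have hfA : f ≤ᵐ[stepLaw μ] fun _ => (A : ℝ≥0∞) := by
    filter_upwards [hup] with ω hω
    have h1 : ∀ j : ℕ, f ω ≤ ENNReal.ofReal (A + 1 / ((j : ℝ) + 1)) := fun j =>
      liminf_le_of_frequently_le' ((hω j).mono fun n hn => ENNReal.ofReal_le_ofReal hn.le).frequently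
    have h2 := ge_of_tendsto' (ENNReal.tendsto_ofReal hjlim) h1
    rwa [ENNReal.ofReal_coe_nnreal] at h2
  -- Dropping the first increment changes the displacement bound by a fixed amount, which is
  -- negligible after division by n.
  have hfT1 : ∀ ω, f ω ≤ f fun i => ω (i + 1) := by
    intro ω
    have hz : Tendsto (fun n : ℕ => ENNReal.ofReal (dist o (ω 0 • o) / n)) atTop (𝓝 0) := by
      simpa using ENNReal.tendsto_ofReal
        (tendsto_const_nhds.div_atTop tendsto_natCast_atTop_atTop (a := dist o (ω 0 • o)))
    simp only [hf]
    rw [← liminf_nat_add _ 1, ← ENNReal.liminf_add_of_right_tendsto_zero hz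
      fun n => ENNReal.ofReal (dist o (walk (fun i => ω (i + 1)) n • o) / n)]
    refine liminf_le_liminf ?_
    filter_upwards [eventually_gt_atTop 0] with n hn
    have hn' : (0 : ℝ) < n := by exact_mod_cast hn
    simp only [Pi.add_apply]
    rw [← ENNReal.ofReal_add (by positivity) (by positivity), ← add_div]
    refine ENNReal.ofReal_le_ofReal ?_
    have h1 := dist_walk_add_le o 1 n ω
    rw [dist_walk_one, add_comm 1 n] at h1
    push_cast
    gcongr <;> linarith
  have hfT : ∀ (ω : ℕ → G) (k : ℕ), f ω ≤ f fun i => ω (i + k) := by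
    intro ω k
    induction k with
    | zero => rfl
    | succ k ih =>
      refine ih.trans ((hfT1 _).trans_eq ?_)
      congr 1; ext i; congr 1; ring
  have hfα : ∀ᵐ ω ∂(stepLaw μ), ∀ ε : ℝ≥0∞, 0 < ε → ∃ k : ℕ, 1 ≤ k ∧
      ENNReal.ofReal (dist o (walk ω k • o)) ≤ k * (f ω + ε) := by
    filter_upwards [hfA] with ω hω ε hε
    have hlt : f ω < f ω + ε := ENNReal.lt_add_right (ne_top_of_le_ne_top (by simp) hω) hε.ne'
    obtain ⟨k, hk, hk1⟩ := ((frequently_lt_of_liminf_lt (by isBoundedDefault) hlt).and_eventually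
      (eventually_ge_atTop 1)).exists
    refine ⟨k, hk1, ?_⟩
    have hk' : (0 : ℝ) < k := by exact_mod_cast hk1
    rw [ENNReal.ofReal_div_of_pos hk', ENNReal.ofReal_natCast] at hk
    rw [mul_comm]
    exact (ENNReal.div_le_iff (by exact_mod_cast (Nat.pos_of_ne_zero (by omega)).ne') (by simp)).1 hk.le
  have hint : ∀ n, ∫⁻ ω : ℕ → G, ENNReal.ofReal (dist o (walk ω n • o)) ∂(stepLaw μ) =
      ENNReal.ofReal (E n) := fun n =>
    (ofReal_integral_eq_lintegral_ofReal (integrable_dist_walk μ ho n)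
      (Eventually.of_forall fun ω => dist_nonneg)).symm
  have hAf : (A : ℝ≥0∞) ≤ ∫⁻ ω, f ω ∂(stepLaw μ) := by
    refine le_lintegral_of_liminf μ
      (α := fun n (ω : ℕ → G) => ENNReal.ofReal (dist o (walk ω n • o)))
      (fun n => (measurable_dist_walk o n).ennreal_ofReal) (by rw [hint]; simp)
      (fun ω => by simp [walk]) (fun n m ω => ?_) hfm hfT hfα fun n => ?_
    · rw [← ENNReal.ofReal_add dist_nonneg dist_nonneg]
      exact ENNReal.ofReal_le_ofReal (dist_walk_add_le o n m ω)
    · rw [hint]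
      rcases eq_or_ne n 0 with rfl | hn
      · simp
      · have := hsub.lim_le_div hbdd hn
        rw [← hA, le_div_iff₀ (by exact_mod_cast Nat.pos_of_ne_zero hn), mul_comm] at this
        rw [← ENNReal.ofReal_coe_nnreal, ← ENNReal.ofReal_natCast,
          ← ENNReal.ofReal_mul (Nat.cast_nonneg n)]
        exact ENNReal.ofReal_le_ofReal this
  have hfeq : f =ᵐ[stepLaw μ] fun _ => (A : ℝ≥0∞) := by
    refine ae_eq_of_ae_le_of_lintegral_le hfA ?_ aemeasurable_const (by simpa using hAf)
    exact ne_top_of_le_ne_top (by simp) (lintegral_mono_ae hfA)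
  filter_upwards [hup, hfeq] with ω h1 h2
  refine tendsto_order.2 ⟨fun c hc => ?_, fun c hc => ?_⟩
  · rcases lt_or_ge c 0 with hc0 | hc0
    · exact Eventually.of_forall fun n => hc0.trans_le (by positivity)
    · have hlt : ENNReal.ofReal c < f ω := by
        rw [h2, ← ENNReal.ofReal_coe_nnreal]
        exact (ENNReal.ofReal_lt_ofReal_iff (hc0.trans_lt hc)).2 hc
      filter_upwards [eventually_lt_of_lt_liminf hlt] with n hn
      exact (ENNReal.ofReal_lt_ofReal_iff_of_nonneg hc0).1 hn
  · obtain ⟨j, hj⟩ := (hjlim.eventually_lt_const hc).exists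
    filter_upwards [h1 j] with n hn
    exact hn.trans hj

end Drift

/-! ### Change of base point and sublinear steps. -/

section Tracking

variable {G X : Type*} [Group G] [MetricSpace X] [MulAction G X] [IsIsometricSMul G X]

theorem integrable_dist_smul [MeasurableSpace G] [DiscreteMeasurableSpace G] {μ : Measure G}
    [IsProbabilityMeasure μ] (hμ : HasFiniteFirstMoment X μ) (o : X) :
    Integrable (fun g : G => dist o (g • o)) μ := by
  obtain ⟨x, hx⟩ := hμ
  refine (hx.add (integrable_const (2 * dist o x))).mono'
    Measurable.of_discrete.aestronglyMeasurable (Eventually.of_forall fun g => ?_)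
  rw [Real.norm_of_nonneg dist_nonneg]
  have h1 := dist_triangle4 o x (g • x) (g • o)
  rw [dist_smul, dist_comm x o] at h1
  simp only [Pi.add_apply]
  linarith

theorem GromovAsymptotic.of_dist_le {u v : ℕ → X} {C : ℝ} (h : GromovAsymptotic u u)
    (huv : ∀ n, dist (u n) (v n) ≤ C) : GromovAsymptotic v v := by
  refine (gromovAsymptotic_iff (u 0)).2 fun R => ?_
  obtain ⟨N, hN⟩ := (gromovAsymptotic_iff (u 0)).1 h (R + 2 * C)
  refine ⟨N, fun n hn m hm => ?_⟩
  have h1 := hN n hn m hm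
  have h2 := gromovProduct_le_add_left (u 0) (u n) (v n) (u m)
  have h3 := gromovProduct_le_add_left (u 0) (u m) (v m) (v n)
  rw [gromovProduct_comm _ (u m), gromovProduct_comm _ (v m)] at h3
  linarith [huv n, huv m]

theorem GromovAsymptotic.tendsto_dist {u : ℕ → X} (h : GromovAsymptotic u u) (o : X) :
    Tendsto (fun n => dist o (u n)) atTop atTop := by
  refine tendsto_atTop.2 fun R => ?_
  obtain ⟨N, hN⟩ := (gromovAsymptotic_iff o).1 h R
  filter_upwards [eventually_ge_atTop N] with n hn
  exact (hN n hn n hn).trans (gromovProduct_le_left _ _ _)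

/-- The term s_n/n is a difference of two consecutive averages, the later one rescaled by (n+1)/n,
and both have limit c. -/
theorem tendsto_step_div {s : ℕ → ℝ} {c : ℝ}
    (h : Tendsto (fun n : ℕ => (∑ i ∈ Finset.range n, s i) / n) atTop (𝓝 c)) :
    Tendsto (fun n : ℕ => s n / n) atTop (𝓝 0) := by
  have h1 : Tendsto (fun n : ℕ => ((n : ℝ) + 1) / n) atTop (𝓝 1) := by
    have := (tendsto_const_nhds (x := (1 : ℝ))).add tendsto_one_div_atTop_nhds_zero_nat
    rw [add_zero] at this
    refine this.congr' ?_
    filter_upwards [eventually_gt_atTop 0] with n hn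
    have hn' : (n : ℝ) ≠ 0 := by exact_mod_cast hn.ne'
    field_simp
  have h2 := ((h.comp (tendsto_add_atTop_nat 1)).mul h1).sub h
  rw [mul_one, sub_self] at h2
  refine h2.congr' ?_
  filter_upwards [eventually_gt_atTop 0] with n hn
  have hn' : (n : ℝ) ≠ 0 := by exact_mod_cast hn.ne'
  have hn1 : (n : ℝ) + 1 ≠ 0 := by positivity
  simp only [Function.comp, Finset.sum_range_succ, Nat.cast_add, Nat.cast_one]
  field_simp
  ring

end Tracking

end Hyperbolic

theorem mainTheorem7 {G X : Type*} [Group G] [Countable G]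
    [MeasurableSpace G] [DiscreteMeasurableSpace G]
    [MetricSpace X] [ProperSpace X] [MulAction G X] [IsIsometricSMul G X]
    (hgeod : Hyperbolic.IsGeodesicSpace X)
    (δ : ℝ) (hδ : 0 ≤ δ) (hhyp : Hyperbolic.IsDeltaHyperbolic X δ)
    (hbdry : 3 ≤ ENat.card (Hyperbolic.Boundary X))
    (μ : Measure G) [IsProbabilityMeasure μ]
    (hmoment : Hyperbolic.HasFiniteFirstMoment X μ)
    (hnonelem : ¬ Hyperbolic.IsElementary X (Hyperbolic.supportSubgroup μ))
    (hunbdd : ∃ x : X,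
      ¬ Bornology.IsBounded (MulAction.orbit (Hyperbolic.supportSubgroup μ) x)) :
    ∃ A : ℝ≥0, ∀ x : X, ∀ᵐ ω ∂(Hyperbolic.stepLaw μ),
      (∃ ξ : Hyperbolic.Boundary X,
        Tendsto (fun n : ℕ => Hyperbolic.Compactification.pt (Hyperbolic.walk ω n • x)) atTop
          (𝓝 (Hyperbolic.Compactification.bdry ξ))) ∧
      ∃ γ : ℝ≥0 → X, Isometry γ ∧ γ 0 = x ∧
        Tendsto (fun n : ℕ => dist (Hyperbolic.walk ω n • x) (γ (A * n)) / n) atTop (𝓝 0) := by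
  open Hyperbolic in
  obtain ⟨o, ho⟩ := hunbdd
  have hκ := hhyp.fourPoint hgeod
  obtain ⟨A, hA⟩ := exists_drift μ (integrable_dist_smul hmoment o)
  refine ⟨A, fun x => ?_⟩
  filter_upwards [hA, ae_gromovAsymptotic_walk hgeod hκ μ hnonelem ho,
    ae_tendsto_sum_steps μ (integrable_dist_smul hmoment x)] with ω hω hG hS
  have hGx : GromovAsymptotic (fun n => walk ω n • x) (fun n => walk ω n • x) :=
    hG.of_dist_le (C := dist o x) fun n => (dist_smul _ _ _).le
  refine ⟨⟨_, tendsto_boundary_mk ⟨_, hGx⟩⟩, ?_⟩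
  refine hκ.exists_ray_tracking hgeod x _ (hGx.tendsto_dist x) ?_ ?_
  -- The displacements of x and o differ by at most 2d(o,x), so the rate A found at o is valid at
  -- every x.
  · have hz : Tendsto (fun n : ℕ => 2 * dist o x / (n : ℝ)) atTop (𝓝 0) :=
      tendsto_const_nhds.div_atTop tendsto_natCast_atTop_atTop
    have hd : Tendsto (fun n : ℕ => dist x (walk ω n • x) / n - dist o (walk ω n • o) / n) atTop
        (𝓝 0) := by
      refine squeeze_zero_norm (fun n => ?_) hz
      rw [← sub_div, norm_div, Real.norm_of_nonneg (Nat.cast_nonneg n), Real.norm_eq_abs]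
      gcongr
      have h1 := dist_triangle4 x o (walk ω n • o) (walk ω n • x)
      have h2 := dist_triangle4 o x (walk ω n • x) (walk ω n • o)
      rw [dist_smul, dist_comm x o] at h1
      rw [dist_smul, dist_comm x o] at h2
      rw [abs_le]
      constructor <;> linarith
    simpa using hd.add hω
  · have hstep := tendsto_step_div hS
    refine hstep.congr fun n => ?_
    rw [walk, mul_smul, dist_smul]
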